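/- Let $E=\mathbb R^q$ with its Euclidean norm and Borel $\sigma$-field, and let $M_1(E)$ be the set of Borel probability measures on $E$ with the narrow topology (convergence in law). Let $\alpha\in M_1(E)$, and for $\beta\in M_1(E)$ let $H(\beta\mid\alpha)$ be the relative entropy, $H(\beta\mid\alpha)=\int\log\frac{d\beta}{d\alpha}\,d\beta$ if $\beta\ll\alpha$ and this is finite, $+\infty$ otherwise. Let $C\subseteq M_1(E)$ be convex and narrowly closed with $H(C\mid\alpha):=\inf_{\beta\in C}H(\beta\mid\alpha)<+\infty$, and let $\alpha^*$ be the $I$-projection of $\alpha$ on $C$, that is, $\alpha^*\in C$ and $H(\alpha^*\mid\alpha)=H(C\mid\alpha)$. Let $\bar d$ be either the Prohorov metric or the Fortet–Mourier metric $$d_{FM}(\mu,\nu)=\sup\Big\{\int f\,d\mu-\int f\,d\nu:\ \|f\|_\infty+\|f\|_{Lip}\le 1\Big\}$$ on $M_1(E)$. Let $X_1,X_2,\dots$ be i.i.d. random variables with law $\alpha$ on a probability space $(\Omega,\mathbb P)$, and let $L_n=\frac1n\sum_{i=1}^n\delta_{X_i}$. For $b>0$ put $\varepsilon_n=2/n^b$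 and $$C_n=\Big\{\nu\in M_1(E):\ \inf_{\mu\in C}\bar d(\mu,\nu)\le\varepsilon_n\Big\},$$ and let $\alpha^n_{C_n,k}$ be the law of $(X_1,\dots,X_k)$ under $\mathbb P$ conditionally on $\{L_n\in C_n\}$. We say that the conditioning principle holds for the exponent $b$ if $\mathbb P(L_n\in C_n)>0$ for all large $n$ and, for every $k$, $\alpha^n_{C_n,k}\to(\alpha^*)^{\otimes k}$ in total variation as $n\to\infty$. Then: 1. If $\int\|x\|^a\,d\alpha^*<\infty$ for some $a>q$, then the conditioning principle holds for every $b$ with $0<b<\dfrac{1-q/a}{2+q}$. This moment condition is satisfied in particular if $\int e^{\lambda\|x\|^a}\,d\alpha<\infty$ for some $\lambda>0$. 2. The conditioning principle holds for every $b$ with $0<b<\dfrac1{2+q}$ in each of the following two cases: (i) $\int e^{\lambda\|x\|^c}\,d\alpha^*<\infty$ for some $\lambda>0$ and some $c>0$; (ii) $\int\|x\|^a\,d\alpha^*<\infty$ for some $a>q$, and $\log\frac{d\alpha^*}{d\alpha}$ (a version of it) is bounded and continuous on $E$. -/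

import Mathlib

open MeasureTheory ProbabilityTheory Filter Topology
open scoped ENNReal NNReal

noncomputable section

namespace GibbsConditioning

variable {E : Type*} [MeasurableSpace E]

/-- `H(C ∣ α) = inf {H(β ∣ α) : β ∈ C}`; it is `∞` for empty `C`. -/
def entropyInf (C : Set (ProbabilityMeasure E)) (α : ProbabilityMeasure E) : ℝ≥0∞ :=
  ⨅ β ∈ C, InformationTheory.klDiv (β : Measure E) (α : Measure E)

/-- `αs` is the (non generalized) `I`-projection of `α` on `C`: it lies in `C` and minimizes the
relative entropy with respect to `α` among the elements of `C`. -/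
structure IsIProjection (C : Set (ProbabilityMeasure E)) (α αs : ProbabilityMeasure E) : Prop where
  mem : αs ∈ C
  klDiv_eq : InformationTheory.klDiv (αs : Measure E) (α : Measure E) = entropyInf C α

/-- Convexity of a set of probability measures, seen in the cone of nonnegative measures. -/
def IsConvexSet (C : Set (ProbabilityMeasure E)) : Prop :=
  Convex ℝ≥0 ((fun ν : ProbabilityMeasure E => (ν : Measure E)) '' C)

/-- The Prohorov metric. -/
def prohorovDist [PseudoEMetricSpace E] (μ ν : ProbabilityMeasure E) : ℝ :=
  levyProkhorovDist (μ : Measure E) (ν : Measure E)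

/-- The Fortet-Mourier metric: the supremum of `∫ f dμ - ∫ f dν` over all bounded Lipschitz `f`
whose sup norm and Lipschitz constant add up to at most `1`. -/
def fortetMourierDist [PseudoEMetricSpace E] (μ ν : ProbabilityMeasure E) : ℝ :=
  sSup {r : ℝ | ∃ (f : E → ℝ) (M L : ℝ≥0), (∀ x, |f x| ≤ M) ∧ LipschitzWith L f ∧ M + L ≤ 1 ∧
    r = ∫ x, f x ∂(μ : Measure E) - ∫ x, f x ∂(ν : Measure E)}

/-- `C^ε = {ν : dist(C, ν) ≤ ε}`, for a distance `dbar` on probability measures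
(meant for nonempty `C`). -/
def enlargement (dbar : ProbabilityMeasure E → ProbabilityMeasure E → ℝ)
    (C : Set (ProbabilityMeasure E)) (ε : ℝ) : Set (ProbabilityMeasure E) :=
  {ν | (⨅ μ : C, dbar (μ : ProbabilityMeasure E) ν) ≤ ε}

/-- The empirical measure `(1/n) ∑ δ_{x_i}` of the first `n` terms of a sequence (for `n ≥ 1`;
the zero measure for `n = 0`). -/
def empiricalMeasure (n : ℕ) (x : ℕ → E) : Measure E :=
  (n : ℝ≥0∞)⁻¹ • ∑ i ∈ Finset.range n, Measure.dirac (x i)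

/-- The event `{L_n ∈ A}`, for the empirical measure `L_n` of the first `n` variables. -/
def empiricalEvent {Ω : Type*} (X : ℕ → Ω → E) (n : ℕ) (A : Set (ProbabilityMeasure E)) : Set Ω :=
  {ω | ∃ ν ∈ A, (ν : Measure E) = empiricalMeasure n (fun i => X i ω)}

/-- The law of the first `k` variables, conditionally on `L_n ∈ A`. (It is the zero measure
if the conditioning event has probability `0`.) -/
def conditionalLaw {Ω : Type*} [MeasurableSpace Ω] (P : Measure Ω) (X : ℕ → Ω → E) (n k : ℕ)
    (A : Set (ProbabilityMeasure E)) : Measure (Fin k → E) :=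
  (P[|empiricalEvent X n A]).map (fun ω (i : Fin k) => X i ω)

instance {Ω : Type*} [MeasurableSpace Ω] (P : Measure Ω) (X : ℕ → Ω → E) (n k : ℕ)
    (A : Set (ProbabilityMeasure E)) : IsFiniteMeasure (conditionalLaw P X n k A) := by
  unfold conditionalLaw; infer_instance

/-- The total variation norm `‖μ - ν‖_TV`. -/
def tvDist {F : Type*} [MeasurableSpace F] (μ ν : Measure F) [IsFiniteMeasure μ]
    [IsFiniteMeasure ν] : ℝ≥0∞ :=
  (μ.toSignedMeasure - ν.toSignedMeasure).totalVariation Set.univ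

/-- The Gibbs conditioning principle for the shrinking enlargements `A n`: the conditioning events
`{L_n ∈ A n}` have positive probability for large `n`, and for every `k` the law of the first `k`
variables given `L_n ∈ A n` converges to `αs^{⊗k}` in total variation. -/
def GibbsConvergence {Ω : Type*} [MeasurableSpace Ω] (P : Measure Ω) (X : ℕ → Ω → E)
    (A : ℕ → Set (ProbabilityMeasure E)) (αs : ProbabilityMeasure E) : Prop :=
  (∀ᶠ n in atTop, 0 < P (empiricalEvent X n (A n))) ∧
  ∀ k : ℕ, Tendsto
    (fun n => tvDist (conditionalLaw P X n k (A n)) (Measure.pi fun _ : Fin k => (αs : Measure E)))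
    atTop (𝓝 0)

end GibbsConditioning

end

/-!
Write `H = H(αs ∣ α)`, `C_n` for the enlargement of `C` by `ε_n = 2 / n ^ b`, `Q_n` for the law of
the sample `(X_1, …, X_n)` conditionally on `L_n ∈ C_n`, and `R` for the law of its first `k`
coordinates. A single argument yields every case: it uses of the distance only the properties
collected in `AdmissibleDist`, and of `αs` only a moment of order `a > q`; it reaches all exponents
`b < 1 / (2 + q)` (`gibbsConvergence_of_moment`).

*Lower bound.* Under `αs^{⊗n}`, the Prohorov distance from `L_n` to `αs` is at most `n ^ (-b)` with
probability tending to `1` (`eventually_measureReal_prohorovDist_le`). Indeed, on a grid of cells of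
diameter `r`, the mean error of `L_n` is at most `n ^ (-1/2)` times the sum of the square roots of
the masses of the cells, and by Cauchy-Schwarz the moment of order `a > q` bounds this sum by a
multiple of `r ^ (-q/2)`. Since both distances are at most twice the Prohorov distance, `L_n ∈ C_n`
with probability tending to `1` under `αs^{⊗n}`. The entropy inequality transfers this to `α^{⊗n}`:
for every `η > 0`, `P(L_n ∈ C_n) > exp (-n (H + η))` for large `n` (`exists_eventually_exp_lt_pi`).

*Upper bound for the entropy of `R`.* The entropy of `Q_n` relative to `α^{⊗n}` is
`-log P(L_n ∈ C_n) ≤ n (H + η)`. Relative entropy with respect to a product measure is superadditive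
(`sum_klDiv_map_le`), and `Q_n` is exchangeable, so that its `n / k` disjoint blocks of length `k`
all have law `R`. Hence `H(R ∣ α^{⊗k})` is at most about `k H` (`klDiv_cond_pi_map_le`).

*Lower bound for the entropy of the midpoint.* The one-dimensional marginal of `Q_n` is the
barycenter of the random measure `L_n`, which takes its values in the closed convex set `C_n`; hence
it belongs to `C_n` (`marginal_mem_of_ae_tupleEmpirical_mem`), and so do the marginals of the
midpoint of `R` and `αs^{⊗k}`. As the infimum of the entropy on `C_n` converges to `H`
(`eventually_le_klDiv`), superadditivity bounds the entropy of this midpoint from below by about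
`k H`.

*Conclusion.* The sum of the entropies of `R` and of `αs^{⊗k}` thus exceeds twice the entropy of
their midpoint by an arbitrarily small amount. A quantitative form of the strict convexity of the
entropy (`integral_abs_rnDeriv_sub_le`) then shows that `R` and `αs^{⊗k}` are close in total
variation.

The exponential moment of `α` gives the moment of `αs` by the entropy inequality
(`integrable_of_integrable_exp`).
-/

namespace GibbsConditioning

open InformationTheory

/-! ### Relative entropy and the `L¹` distance -/

section Entropy

open Real

variable {F : Type*} [MeasurableSpace F]

/-- The bound `log u ≤ u - 1` at `u = √(s / x)`. -/
lemma two_mul_sub_sqrt_le {x s : ℝ} (hx : 0 ≤ x) (hs : 0 < s) :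
    2 * x - 2 * √x * √s ≤ x * log x - x * log s := by
  rcases hx.eq_or_lt with rfl | hx
  · simp
  have hsx := Real.sqrt_pos.2 hx
  have hss := Real.sqrt_pos.2 hs
  have h := Real.log_le_sub_one_of_pos (div_pos hss hsx)
  rw [Real.log_div hss.ne' hsx.ne', Real.log_sqrt hs.le, Real.log_sqrt hx.le] at h
  have h2 : x * (√s / √x) = √x * √s := by
    field_simp
    rw [Real.sq_sqrt hx.le]
  nlinarith

/-- Uniform convexity of `x log x`, measured by the Hellinger distance. -/
lemma hellinger_le_klFun_gap {x y : ℝ} (hx : 0 ≤ x) (hy : 0 ≤ y) :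
    (√x - √y) ^ 2 / 2 ≤ klFun x + klFun y - 2 * klFun ((x + y) / 2) := by
  rcases (add_nonneg hx hy).eq_or_lt with h | h
  · have hx0 : x = 0 := by linarith
    have hy0 : y = 0 := by linarith
    simp [hx0, hy0, klFun]
    norm_num
  have hs : 0 < (x + y) / 2 := by linarith
  have h1 := two_mul_sub_sqrt_le hx hs
  have h2 := two_mul_sub_sqrt_le hy hs
  have e1 := Real.sq_sqrt hx
  have e2 := Real.sq_sqrt hy
  have e3 := Real.sq_sqrt hs.le
  simp only [klFun_apply]
  -- with `s = (x + y) / 2`, the gap is at least `4 s - 2 √s (√x + √y)`; the square below bounds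
  -- `√s (√x + √y)` so that half of `2 (x + y) - (√x + √y) ^ 2 = (√x - √y) ^ 2` remains
  nlinarith [sq_nonneg (2 * √((x + y) / 2) - (√x + √y))]

variable {μ ν ρ : Measure F}

/-- The midpoint `(μ + ν) / 2` of two measures, with coefficients in `ℝ≥0` as in the definition of
`IsConvexSet`. -/
noncomputable def midpointMeasure (μ ν : Measure F) : Measure F :=
  (2⁻¹ : ℝ≥0) • μ + (2⁻¹ : ℝ≥0) • ν

instance [IsProbabilityMeasure μ] [IsProbabilityMeasure ν] :
    IsProbabilityMeasure (midpointMeasure μ ν) where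
  measure_univ := by
    simp [midpointMeasure, ENNReal.smul_def, ENNReal.inv_two_add_inv_two]

lemma midpointMeasure_map {G : Type*} [MeasurableSpace G] {f : F → G} (hf : Measurable f) :
    (midpointMeasure μ ν).map f = midpointMeasure (μ.map f) (ν.map f) := by
  rw [midpointMeasure, Measure.map_add _ _ hf]
  ext s hs
  simp [midpointMeasure, Measure.map_apply hf hs]

lemma integral_toReal_rnDeriv_eq_one [IsProbabilityMeasure μ] [SigmaFinite ρ] (h : μ ≪ ρ) :
    ∫ x, (μ.rnDeriv ρ x).toReal ∂ρ = 1 := by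
  rw [Measure.integral_toReal_rnDeriv h]; simp

lemma integrable_klFun_of_klDiv_ne_top [IsFiniteMeasure μ] [IsFiniteMeasure ρ]
    (h : klDiv μ ρ ≠ ∞) :
    Integrable (fun x => klFun (μ.rnDeriv ρ x).toReal) ρ := by
  obtain ⟨hac, hint⟩ := klDiv_ne_top_iff.1 h
  exact (integrable_klFun_rnDeriv_iff hac).2 hint

lemma klDiv_ne_top_of_integrable_klFun [IsFiniteMeasure μ] [IsFiniteMeasure ρ]
    (hac : μ ≪ ρ)
    (h : Integrable (fun x => klFun (μ.rnDeriv ρ x).toReal) ρ) : klDiv μ ρ ≠ ∞ :=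
  klDiv_ne_top hac ((integrable_klFun_rnDeriv_iff hac).1 h)

lemma rnDeriv_midpointMeasure [IsFiniteMeasure μ] [IsFiniteMeasure ν] [SigmaFinite ρ] :
    (fun x => ((midpointMeasure μ ν).rnDeriv ρ x).toReal) =ᵐ[ρ]
      fun x => ((μ.rnDeriv ρ x).toReal + (ν.rnDeriv ρ x).toReal) / 2 := by
  filter_upwards [Measure.rnDeriv_add ((2⁻¹ : ℝ≥0) • μ) ((2⁻¹ : ℝ≥0) • ν) ρ,
    Measure.rnDeriv_smul_left μ ρ (2⁻¹ : ℝ≥0), Measure.rnDeriv_smul_left ν ρ (2⁻¹ : ℝ≥0),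
    μ.rnDeriv_lt_top ρ, ν.rnDeriv_lt_top ρ] with x h1 h2 h3 h4 h5
  rw [midpointMeasure, h1, Pi.add_apply, h2, h3]
  simp only [Pi.smul_apply, ENNReal.smul_def, smul_eq_mul]
  rw [ENNReal.toReal_add (by finiteness) (by finiteness), ENNReal.toReal_mul, ENNReal.toReal_mul]
  simp
  ring

lemma midpointMeasure_ac (hμ : μ ≪ ρ) (hν : ν ≪ ρ) : midpointMeasure μ ν ≪ ρ :=
  Measure.AbsolutelyContinuous.add_left (hμ.smul_left _) (hν.smul_left _)

lemma klDiv_midpointMeasure_ne_top [IsProbabilityMeasure μ] [IsProbabilityMeasure ν]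
    [IsProbabilityMeasure ρ] (hμ : klDiv μ ρ ≠ ∞) (hν : klDiv ν ρ ≠ ∞) :
    klDiv (midpointMeasure μ ν) ρ ≠ ∞ := by
  have iμ := integrable_klFun_of_klDiv_ne_top hμ
  have iν := integrable_klFun_of_klDiv_ne_top hν
  refine klDiv_ne_top_of_integrable_klFun
    (midpointMeasure_ac (klDiv_ne_top_iff.1 hμ).1 (klDiv_ne_top_iff.1 hν).1) ?_
  refine (iμ.add iν).mono' (measurable_klFun.comp
    (Measure.measurable_rnDeriv _ _).ennreal_toReal).aestronglyMeasurable ?_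
  filter_upwards [rnDeriv_midpointMeasure (μ := μ) (ν := ν) (ρ := ρ)] with x hx
  have := hellinger_le_klFun_gap (x := (μ.rnDeriv ρ x).toReal) (y := (ν.rnDeriv ρ x).toReal)
    ENNReal.toReal_nonneg ENNReal.toReal_nonneg
  have h0 := klFun_nonneg (x := ((μ.rnDeriv ρ x).toReal + (ν.rnDeriv ρ x).toReal) / 2)
    (by positivity)
  rw [hx, Real.norm_of_nonneg h0, Pi.add_apply]
  nlinarith [sq_nonneg (√(μ.rnDeriv ρ x).toReal - √(ν.rnDeriv ρ x).toReal)]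

/-- If the relative entropy is nearly affine between `μ` and `ν`, then `μ` and `ν` are close
in `L¹`: a quantitative form of the parallelogram identity for the relative entropy. -/
lemma integral_abs_rnDeriv_sub_le [IsProbabilityMeasure μ] [IsProbabilityMeasure ν]
    [IsProbabilityMeasure ρ] (hμ : klDiv μ ρ ≠ ∞) (hν : klDiv ν ρ ≠ ∞) {t : ℝ} (ht : 0 < t)
    (hgap : (klDiv μ ρ).toReal + (klDiv ν ρ).toReal
      - 2 * (klDiv (midpointMeasure μ ν) ρ).toReal ≤ t ^ 2) :
    ∫ x, |(μ.rnDeriv ρ x).toReal - (ν.rnDeriv ρ x).toReal| ∂ρ ≤ 3 * t := by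
  have aμ := (klDiv_ne_top_iff.1 hμ).1
  have aν := (klDiv_ne_top_iff.1 hν).1
  have iμ := integrable_klFun_of_klDiv_ne_top hμ
  have iν := integrable_klFun_of_klDiv_ne_top hν
  have im := integrable_klFun_of_klDiv_ne_top (klDiv_midpointMeasure_ne_top hμ hν)
  have dμ : Integrable (fun x => (μ.rnDeriv ρ x).toReal) ρ := Measure.integrable_toReal_rnDeriv
  have dν : Integrable (fun x => (ν.rnDeriv ρ x).toReal) ρ := Measure.integrable_toReal_rnDeriv
  rw [toReal_klDiv_eq_integral_klFun aμ, toReal_klDiv_eq_integral_klFun aν,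
    toReal_klDiv_eq_integral_klFun (midpointMeasure_ac aμ aν)] at hgap
  have key : ∀ᵐ x ∂ρ, |(μ.rnDeriv ρ x).toReal - (ν.rnDeriv ρ x).toReal| ≤
      t⁻¹ * (klFun (μ.rnDeriv ρ x).toReal + klFun (ν.rnDeriv ρ x).toReal
        - 2 * klFun ((midpointMeasure μ ν).rnDeriv ρ x).toReal)
      + t * ((μ.rnDeriv ρ x).toReal + (ν.rnDeriv ρ x).toReal) := by
    filter_upwards [rnDeriv_midpointMeasure (μ := μ) (ν := ν) (ρ := ρ)] with x hx
    rw [hx]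
    generalize hX : (μ.rnDeriv ρ x).toReal = X
    generalize hY : (ν.rnDeriv ρ x).toReal = Y
    have hX0 : 0 ≤ X := hX ▸ ENNReal.toReal_nonneg
    have hY0 : 0 ≤ Y := hY ▸ ENNReal.toReal_nonneg
    have h := hellinger_le_klFun_gap hX0 hY0
    set G := klFun X + klFun Y - 2 * klFun ((X + Y) / 2)
    have e1 := Real.sq_sqrt hX0
    have e2 := Real.sq_sqrt hY0
    have hu := Real.sqrt_nonneg X
    have hv := Real.sqrt_nonneg Y
    have hf : |X - Y| = |√X - √Y| * (√X + √Y) := by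
      rw [← abs_of_nonneg (add_nonneg hu hv), ← abs_mul]
      congr 1; nlinarith
    rw [hf]
    set d := |√X - √Y| with hd
    have hd2 : d ^ 2 = (√X - √Y) ^ 2 := sq_abs _
    -- `d (√X + √Y) ≤ d² / (2t) + t (√X + √Y)² / 2`
    have h3 : t⁻¹ * (d ^ 2 / 2) ≤ t⁻¹ * G := by
      rw [hd2]; exact mul_le_mul_of_nonneg_left h (inv_nonneg.2 ht.le)
    have h4 : d * (√X + √Y) ≤ t⁻¹ * (d ^ 2 / 2) + t * ((√X + √Y) ^ 2 / 2) := by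
      have h5 : 0 ≤ t⁻¹ * ((d - t * (√X + √Y)) ^ 2 / 2) := by positivity
      have h6 : t⁻¹ * ((d - t * (√X + √Y)) ^ 2 / 2) =
        t⁻¹ * (d ^ 2 / 2) - d * (√X + √Y) + t * ((√X + √Y) ^ 2 / 2) := by
        field_simp; ring
      linarith
    have h7 : (√X + √Y) ^ 2 / 2 ≤ X + Y := by nlinarith [sq_nonneg (√X - √Y)]
    have h8 := mul_le_mul_of_nonneg_left h7 ht.le
    linarith
  have iG : Integrable (fun x => klFun (μ.rnDeriv ρ x).toReal + klFun (ν.rnDeriv ρ x).toReal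
      - 2 * klFun ((midpointMeasure μ ν).rnDeriv ρ x).toReal) ρ :=
    (iμ.add iν).sub (im.const_mul 2)
  have dG : Integrable (fun x => (μ.rnDeriv ρ x).toReal + (ν.rnDeriv ρ x).toReal) ρ := dμ.add dν
  have hint : ∫ x, t⁻¹ * (klFun (μ.rnDeriv ρ x).toReal + klFun (ν.rnDeriv ρ x).toReal
        - 2 * klFun ((midpointMeasure μ ν).rnDeriv ρ x).toReal)
      + t * ((μ.rnDeriv ρ x).toReal + (ν.rnDeriv ρ x).toReal) ∂ρ =
      t⁻¹ * (∫ x, klFun (μ.rnDeriv ρ x).toReal ∂ρ + ∫ x, klFun (ν.rnDeriv ρ x).toReal ∂ρ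
        - 2 * ∫ x, klFun ((midpointMeasure μ ν).rnDeriv ρ x).toReal ∂ρ) + t * (1 + 1) := by
    rw [integral_add (iG.const_mul _) (dG.const_mul _), integral_const_mul, integral_const_mul,
      integral_sub (iμ.fun_add iν) (im.const_mul 2),
      integral_add iμ iν, integral_add dμ dν, integral_const_mul,
      integral_toReal_rnDeriv_eq_one aμ, integral_toReal_rnDeriv_eq_one aν]
  have := integral_mono_ae (dμ.sub dν).abs
    ((iG.const_mul t⁻¹).add (dG.const_mul t)) key
  refine this.trans ?_
  refine hint.le.trans ?_
  have h9 := mul_le_mul_of_nonneg_left hgap (inv_nonneg.2 ht.le)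
  have h10 : t⁻¹ * t ^ 2 = t := by field_simp
  linarith

lemma abs_measureReal_sub_le [IsFiniteMeasure μ] [IsFiniteMeasure ν] [IsFiniteMeasure ρ]
    (hμ : μ ≪ ρ) (hν : ν ≪ ρ) (s : Set F) :
    |μ.real s - ν.real s| ≤
      ∫ x in s, |(μ.rnDeriv ρ x).toReal - (ν.rnDeriv ρ x).toReal| ∂ρ := by
  have dμ : Integrable (fun x => (μ.rnDeriv ρ x).toReal) ρ := Measure.integrable_toReal_rnDeriv
  have dν : Integrable (fun x => (ν.rnDeriv ρ x).toReal) ρ := Measure.integrable_toReal_rnDeriv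
  rw [← Measure.setIntegral_toReal_rnDeriv hμ s, ← Measure.setIntegral_toReal_rnDeriv hν s,
    ← integral_sub dμ.integrableOn dν.integrableOn]
  exact abs_integral_le_integral_abs

lemma tvDist_le_integral_abs [IsFiniteMeasure μ] [IsFiniteMeasure ν] [IsFiniteMeasure ρ]
    (hμ : μ ≪ ρ) (hν : ν ≪ ρ) :
    tvDist μ ν ≤
      ENNReal.ofReal (∫ x, |(μ.rnDeriv ρ x).toReal - (ν.rnDeriv ρ x).toReal| ∂ρ) := by
  have dμ : Integrable (fun x => (μ.rnDeriv ρ x).toReal) ρ := Measure.integrable_toReal_rnDeriv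
  have dν : Integrable (fun x => (ν.rnDeriv ρ x).toReal) ρ := Measure.integrable_toReal_rnDeriv
  have dd : Integrable (fun x => |(μ.rnDeriv ρ x).toReal - (ν.rnDeriv ρ x).toReal|) ρ :=
    (dμ.sub dν).abs
  rw [tvDist, SignedMeasure.totalVariation_eq_variation]
  have h : VectorMeasure.variation (μ.toSignedMeasure - ν.toSignedMeasure) ≤
      ρ.withDensity fun x => ENNReal.ofReal
        |(μ.rnDeriv ρ x).toReal - (ν.rnDeriv ρ x).toReal| := by
    refine VectorMeasure.variation_le_of_forall_enorm_le ?_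
    intro s hs
    rw [withDensity_apply _ hs, _root_.sub_apply,
      Measure.toSignedMeasure_apply_measurable hs, Measure.toSignedMeasure_apply_measurable hs,
      ← ofReal_integral_eq_lintegral_ofReal dd.integrableOn
        (ae_of_all _ fun x => abs_nonneg _), Real.enorm_eq_ofReal_abs]
    exact ENNReal.ofReal_le_ofReal (abs_measureReal_sub_le hμ hν s)
  refine (h Set.univ).trans ?_
  rw [withDensity_apply _ MeasurableSet.univ, Measure.restrict_univ,
    ← ofReal_integral_eq_lintegral_ofReal dd (ae_of_all _ fun x => abs_nonneg _)]

end Entropy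

/-! ### Variational formula, superadditivity and tensorization of the relative entropy -/

section Variational

open Real

variable {F : Type*} [MeasurableSpace F] {μ ρ : Measure F}

/-- The Fenchel-Young inequality for the convex function `klFun`. The hypothesis `h` excludes the
junk value `log 0 = 0`. -/
lemma mul_log_le_klFun_add {f g : ℝ} (hf : 0 ≤ f) (hg : 0 ≤ g) (h : f ≠ 0 → 0 < g) :
    f * log g ≤ klFun f + g - 1 := by
  rcases hf.eq_or_lt with rfl | hf
  · simpa [klFun] using hg
  have hg := h hf.ne'
  have h1 := Real.log_le_sub_one_of_pos (div_pos hg hf)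
  rw [Real.log_div hg.ne' hf.ne'] at h1
  have h2 : f * (g / f) = g := by field_simp
  rw [klFun_apply]
  nlinarith

/-- One half of the Gibbs (Donsker-Varadhan) variational formula, in the form `log u ≤ u - 1` of its
logarithmic term. -/
lemma integral_log_le_klDiv [IsFiniteMeasure μ] [IsProbabilityMeasure ρ] (hμ : klDiv μ ρ ≠ ∞)
    {G : F → ℝ} (hG0 : ∀ x, 0 ≤ G x) (hpos : ∀ᵐ x ∂μ, 0 < G x)
    (hlog : Integrable (fun x => log (G x)) μ) (hG : Integrable G ρ) :
    ∫ x, log (G x) ∂μ ≤ (klDiv μ ρ).toReal + ∫ x, G x ∂ρ - 1 := by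
  have hac := (klDiv_ne_top_iff.1 hμ).1
  have iμ := integrable_klFun_of_klDiv_ne_top hμ
  have i1 : Integrable (fun x => klFun (μ.rnDeriv ρ x).toReal + G x - 1) ρ :=
    (iμ.add hG).sub (integrable_const 1)
  have i2 : Integrable (fun x => klFun (μ.rnDeriv ρ x).toReal + G x) ρ := iμ.add hG
  rw [toReal_klDiv_eq_integral_klFun hac, ← integral_toReal_rnDeriv_mul hac]
  have : ∫ x, (klFun (μ.rnDeriv ρ x).toReal + G x - 1) ∂ρ =
      ∫ x, klFun (μ.rnDeriv ρ x).toReal ∂ρ + ∫ x, G x ∂ρ - 1 := by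
    rw [integral_sub i2 (integrable_const 1), integral_add iμ hG]; simp
  rw [← this]
  refine integral_mono_ae ((integrable_toReal_rnDeriv_mul_iff hac).2 hlog) i1 ?_
  filter_upwards [Measure.ae_rnDeriv_ne_zero_imp_of_ae ρ hpos] with x hx
  exact mul_log_le_klFun_add ENNReal.toReal_nonneg (hG0 x)
    fun h => hx fun h0 => h (by simp [h0])

variable {Ω : Type*} [MeasurableSpace Ω]

/-- Superadditivity of the relative entropy with respect to independent variables. -/
lemma sum_klDiv_map_le {P P' : Measure Ω} [IsProbabilityMeasure P] [IsProbabilityMeasure P']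
    {ι : Type*} [Fintype ι] {Y : ι → Ω → F} (hY : ∀ i, Measurable (Y i)) (hind : iIndepFun Y P)
    (h : klDiv P' P ≠ ∞) :
    ∑ i, (klDiv (P'.map (Y i)) (P.map (Y i))).toReal ≤ (klDiv P' P).toReal := by
  have hPi : ∀ i, IsProbabilityMeasure (P.map (Y i)) :=
    fun i => Measure.isProbabilityMeasure_map (hY i).aemeasurable
  have hPi' : ∀ i, IsProbabilityMeasure (P'.map (Y i)) :=
    fun i => Measure.isProbabilityMeasure_map (hY i).aemeasurable
  have hfin : ∀ i, klDiv (P'.map (Y i)) (P.map (Y i)) ≠ ∞ :=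
    fun i => ne_top_of_le_ne_top h (klDiv_map_le _ _ (hY i))
  have hac := fun i => (klDiv_ne_top_iff.1 (hfin i)).1
  have hint := fun i => (klDiv_ne_top_iff.1 (hfin i)).2
  set g : ι → F → ℝ := fun i y => ((P'.map (Y i)).rnDeriv (P.map (Y i)) y).toReal with hg
  have hgm : ∀ i, Measurable (g i) := fun i => (Measure.measurable_rnDeriv _ _).ennreal_toReal
  have hgi : ∀ i, Integrable (g i) (P.map (Y i)) := fun i => Measure.integrable_toReal_rnDeriv
  have hgpos : ∀ i, ∀ᵐ ω ∂P', 0 < g i (Y i ω) := by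
    intro i
    refine ae_of_ae_map (f := Y i) (p := fun y => 0 < g i y) (hY i).aemeasurable ?_
    filter_upwards [Measure.rnDeriv_pos (hac i),
      (hac i).ae_le (Measure.rnDeriv_lt_top (P'.map (Y i)) (P.map (Y i)))] with y h1 h2
    exact ENNReal.toReal_pos h1.ne' h2.ne
  have hlogi : ∀ i, Integrable (fun ω => log (g i (Y i ω))) P' := fun i =>
    (integrable_map_measure (hint i).aestronglyMeasurable (hY i).aemeasurable).1 (hint i)
  have hallpos : ∀ᵐ ω ∂P', ∀ i, 0 < g i (Y i ω) := ae_all_iff.2 hgpos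
  have hlogsum : (fun ω => log (∏ i, g i (Y i ω))) =ᵐ[P'] fun ω => ∑ i, log (g i (Y i ω)) := by
    filter_upwards [hallpos] with ω hω
    exact Real.log_prod fun i _ => (hω i).ne'
  have hprod : ∫ ω, ∏ i, g i (Y i ω) ∂P = 1 := by
    rw [hind.integral_fun_prod_comp (fun i => (hY i).aemeasurable)
      (fun i => (hgm i).aestronglyMeasurable)]
    refine Finset.prod_eq_one fun i _ => ?_
    rw [← integral_map (hY i).aemeasurable (hgm i).aestronglyMeasurable]
    exact integral_toReal_rnDeriv_eq_one (hac i)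
  have hprodi : Integrable (fun ω => ∏ i, g i (Y i ω)) P := by
    by_contra hcon
    rw [integral_undef hcon] at hprod
    exact zero_ne_one hprod
  -- the variational formula, for the density of the product of the marginal laws
  have key := integral_log_le_klDiv h (G := fun ω => ∏ i, g i (Y i ω))
    (fun ω => Finset.prod_nonneg fun i _ => ENNReal.toReal_nonneg)
    (by filter_upwards [hallpos] with ω hω using Finset.prod_pos fun i _ => hω i)
    ((integrable_congr hlogsum).2 (integrable_finsetSum _ fun i _ => hlogi i)) hprodi
  rw [hprod, integral_congr_ae hlogsum, integral_finsetSum _ fun i _ => hlogi i] at key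
  refine (Finset.sum_le_sum fun i _ => ?_).trans (key.trans (by linarith))
  rw [toReal_klDiv_of_measure_eq (hac i) (by simp)]
  exact (integral_map (hY i).aemeasurable (hint i).aestronglyMeasurable).le

/-- The relative entropy of a conditioned probability measure. -/
lemma klDiv_cond {P : Measure Ω} [IsProbabilityMeasure P] {A : Set Ω} (hA : MeasurableSet A)
    (hPA : P A ≠ 0) : klDiv (P[|A]) P ≠ ∞ ∧ (klDiv (P[|A]) P).toReal = -log (P.real A) := by
  have hprob : IsProbabilityMeasure (P[|A]) := cond_isProbabilityMeasure hPA
  have hac : P[|A] ≪ P := cond_absolutelyContinuous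
  have hllr : llr (P[|A]) P =ᵐ[P[|A]] fun _ => -log (P.real A) := by
    have h1 : ∀ᵐ ω ∂P[|A], ω ∈ A := ae_cond_mem hA
    have h2 : (P[|A]).rnDeriv P =ᵐ[P] (P A)⁻¹ • A.indicator 1 := by
      refine (Measure.rnDeriv_smul_left_of_ne_top (P.restrict A) P (by simpa using hPA)).trans ?_
      exact (Measure.rnDeriv_restrict_self P hA).const_smul _
    filter_upwards [h1, hac.ae_le h2] with ω h3 h4
    simp [llr, h4, h3, Real.log_inv, measureReal_def]
  have hint : Integrable (llr (P[|A]) P) (P[|A]) := (integrable_congr hllr).2 (integrable_const _)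
  refine ⟨klDiv_ne_top hac hint, ?_⟩
  rw [toReal_klDiv_of_measure_eq hac (by simp), integral_congr_ae hllr]
  simp

end Variational

section Product

open Real

variable {F : Type*} [MeasurableSpace F] {μ ρ : Measure F}
  [IsProbabilityMeasure μ] [IsProbabilityMeasure ρ] {ι : Type*} [Fintype ι]

lemma pi_eq_withDensity (h : μ ≪ ρ) :
    Measure.pi (fun _ : ι => μ) =
      (Measure.pi fun _ : ι => ρ).withDensity fun x => ∏ i, μ.rnDeriv ρ (x i) := by
  refine Measure.pi_eq fun s hs => ?_
  rw [withDensity_apply _ (MeasurableSet.univ_pi hs),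
    ← lintegral_indicator (MeasurableSet.univ_pi hs)]
  have : ∀ x : ι → F, (Set.univ.pi s).indicator (fun x => ∏ i, μ.rnDeriv ρ (x i)) x =
      ∏ i, (s i).indicator (μ.rnDeriv ρ) (x i) := by
    intro x
    by_cases hx : x ∈ Set.univ.pi s
    · rw [Set.indicator_of_mem hx]
      exact Finset.prod_congr rfl fun i _ => (Set.indicator_of_mem (hx i trivial) _).symm
    · rw [Set.indicator_of_notMem hx]
      simp only [Set.mem_pi, Set.mem_univ, true_implies, not_forall] at hx
      obtain ⟨i, hi⟩ := hx
      exact (Finset.prod_eq_zero (Finset.mem_univ i) (Set.indicator_of_notMem hi _)).symm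
  simp_rw [this]
  have hm : ∀ i, Measurable ((s i).indicator (μ.rnDeriv ρ)) :=
    fun i => (Measure.measurable_rnDeriv _ _).indicator (hs i)
  rw [lintegral_prod_eq_prod_lintegral_of_indepFun Finset.univ
    (fun i (x : ι → F) => (s i).indicator (μ.rnDeriv ρ) (x i))
    (iIndepFun_pi fun i => (hm i).aemeasurable) (fun i => (hm i).comp (measurable_pi_apply i))]
  refine Finset.prod_congr rfl fun i _ => ?_
  rw [(measurePreserving_eval (fun _ : ι => ρ) i).lintegral_comp (hm i),
    lintegral_indicator (hs i), Measure.setLIntegral_rnDeriv h]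

/-- Tensorization of the relative entropy. -/
lemma klDiv_pi (h : klDiv μ ρ ≠ ∞) :
    klDiv (Measure.pi fun _ : ι => μ) (Measure.pi fun _ : ι => ρ) ≠ ∞ ∧
      (klDiv (Measure.pi fun _ : ι => μ) (Measure.pi fun _ : ι => ρ)).toReal =
        Fintype.card ι * (klDiv μ ρ).toReal := by
  obtain ⟨hac, hint⟩ := klDiv_ne_top_iff.1 h
  have hpi := pi_eq_withDensity (ι := ι) hac
  have hm : Measurable fun x : ι → F => ∏ i, μ.rnDeriv ρ (x i) :=
    Finset.measurable_fun_prod _ fun i _ =>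
      (Measure.measurable_rnDeriv μ ρ).comp (measurable_pi_apply i)
  have hac' : Measure.pi (fun _ : ι => μ) ≪ Measure.pi fun _ : ι => ρ :=
    hpi ▸ withDensity_absolutelyContinuous _ _
  have hrn : (Measure.pi fun _ : ι => μ).rnDeriv (Measure.pi fun _ : ι => ρ)
      =ᵐ[Measure.pi fun _ : ι => ρ] fun x => ∏ i, μ.rnDeriv ρ (x i) := by
    conv_lhs => rw [hpi]
    exact Measure.rnDeriv_withDensity _ hm
  have hcoord : ∀ᵐ x ∂(Measure.pi fun _ : ι => μ), ∀ i,
      0 < μ.rnDeriv ρ (x i) ∧ μ.rnDeriv ρ (x i) < ∞ := by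
    refine ae_all_iff.2 fun i => ?_
    refine (Measure.quasiMeasurePreserving_eval (fun _ : ι => μ) i).ae
      (p := fun y => 0 < μ.rnDeriv ρ y ∧ μ.rnDeriv ρ y < ∞) ?_
    filter_upwards [Measure.rnDeriv_pos hac, hac.ae_le (Measure.rnDeriv_lt_top μ ρ)] with y h1 h2
    exact ⟨h1, h2⟩
  have hllr : llr (Measure.pi fun _ : ι => μ) (Measure.pi fun _ : ι => ρ)
      =ᵐ[Measure.pi fun _ : ι => μ] fun x => ∑ i, llr μ ρ (x i) := by
    filter_upwards [hac'.ae_le hrn, hcoord] with x h1 h2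
    simp only [llr]
    rw [h1, ENNReal.toReal_prod, Real.log_prod]
    exact fun i _ => (ENNReal.toReal_pos (h2 i).1.ne' (h2 i).2.ne).ne'
  have hi : ∀ i, Integrable (fun x : ι → F => llr μ ρ (x i)) (Measure.pi fun _ : ι => μ) :=
    fun i => (measurePreserving_eval (fun _ : ι => μ) i).integrable_comp_of_integrable hint
  refine ⟨klDiv_ne_top hac'
    ((integrable_congr hllr).2 (integrable_finsetSum _ fun i _ => hi i)), ?_⟩
  rw [toReal_klDiv_of_measure_eq hac' (by simp), integral_congr_ae hllr,
    integral_finsetSum _ fun i _ => hi i, toReal_klDiv_of_measure_eq hac (by simp)]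
  have : ∀ i : ι, ∫ x : ι → F, llr μ ρ (x i) ∂(Measure.pi fun _ : ι => μ) = ∫ y, llr μ ρ y ∂μ := by
    intro i
    rw [← integral_map (measurable_pi_apply i).aemeasurable]
    · rw [(measurePreserving_eval (fun _ : ι => μ) i).map_eq]
    · exact (measurable_llr _ _).aestronglyMeasurable
  simp [this]

end Product

/-! ### Minimizers of the relative entropy on decreasing sets -/

section NearMinimizers

open Real

variable {E : Type*} [MeasurableSpace E]

/-- Relative entropy is lower semicontinuous along `L¹`-convergent densities: if the densities form
a Cauchy sequence in `L¹`, the measures converge in total variation to some `γ`, and Fatou's lemma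
along an almost everywhere convergent subsequence bounds the entropy of `γ`. -/
lemma exists_limit_of_cauchy {α : ProbabilityMeasure E} {β : ℕ → ProbabilityMeasure E} {L : ℝ}
    {b c : ℕ → ℝ} (hfin : ∀ n, klDiv (β n : Measure E) α ≠ ∞)
    (hb : Tendsto b atTop (𝓝 0))
    (hcauchy : ∀ n m N, N ≤ n → N ≤ m → ∫ x, |((β n : Measure E).rnDeriv α x).toReal -
      ((β m : Measure E).rnDeriv α x).toReal| ∂(α : Measure E) ≤ b N)
    (hc : Tendsto c atTop (𝓝 L)) (hle : ∀ n, (klDiv (β n : Measure E) α).toReal ≤ c n) :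
    ∃ (γ : ProbabilityMeasure E) (t : ℕ → ℝ), Tendsto t atTop (𝓝 0) ∧
      (∀ n (s : Set E), |(β n : Measure E).real s - (γ : Measure E).real s| ≤ t n) ∧
      klDiv (γ : Measure E) α ≤ ENNReal.ofReal L := by
  have hac := fun n => (klDiv_ne_top_iff.1 (hfin n)).1
  set f : ℕ → E → ℝ := fun n x => ((β n : Measure E).rnDeriv α x).toReal with hf
  have hfi : ∀ n, Integrable (f n) (α : Measure E) := fun n => Measure.integrable_toReal_rnDeriv
  have hdist : ∀ n m, dist ((hfi n).toL1 (f n)) ((hfi m).toL1 (f m)) =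
      ∫ x, |f n x - f m x| ∂(α : Measure E) := by
    intro n m
    rw [dist_eq_norm, ← Integrable.toL1_sub, L1.norm_of_fun_eq_integral_norm]
    simp only [Pi.sub_apply, Real.norm_eq_abs]
  have hcs : CauchySeq fun n => (hfi n).toL1 (f n) :=
    cauchySeq_of_le_tendsto_0 b (fun n m N hn hm => (hdist n m).le.trans (hcauchy n m N hn hm)) hb
  obtain ⟨G, hG⟩ := cauchySeq_tendsto_of_complete hcs
  have hGi : Integrable G (α : Measure E) := L1.integrable_coeFn G
  set t : ℕ → ℝ := fun n => ∫ x, |f n x - G x| ∂(α : Measure E) with ht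
  have ht0 : Tendsto t atTop (𝓝 0) := by
    have := tendsto_iff_dist_tendsto_zero.1 hG
    refine this.congr fun n => ?_
    conv_lhs => rw [← Integrable.toL1_coeFn G hGi]
    rw [dist_eq_norm, ← Integrable.toL1_sub, L1.norm_of_fun_eq_integral_norm]
    simp only [Pi.sub_apply, Real.norm_eq_abs, ht]
  -- an almost everywhere convergent subsequence
  obtain ⟨ns, hns, hae⟩ := (tendstoInMeasure_of_tendsto_Lp hG).exists_seq_tendsto_ae
  have hae' : ∀ᵐ x ∂(α : Measure E), Tendsto (fun k => f (ns k) x) atTop (𝓝 (G x)) := by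
    have h1 : ∀ᵐ x ∂(α : Measure E), ∀ n, ((hfi n).toL1 (f n)) x = f n x :=
      ae_all_iff.2 fun n => (hfi n).coeFn_toL1
    filter_upwards [hae, h1] with x hx h1
    simpa only [h1] using hx
  have hG0 : ∀ᵐ x ∂(α : Measure E), 0 ≤ G x := by
    filter_upwards [hae'] with x hx
    exact ge_of_tendsto' hx fun k => ENNReal.toReal_nonneg
  have hset : ∀ n (s : Set E),
      |(β n : Measure E).real s - ∫ x in s, G x ∂(α : Measure E)| ≤ t n := by
    intro n s
    rw [← Measure.setIntegral_toReal_rnDeriv (hac n) s,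
      ← integral_sub (hfi n).integrableOn hGi.integrableOn]
    refine abs_integral_le_integral_abs.trans ?_
    exact setIntegral_le_integral ((hfi n).sub hGi).abs (ae_of_all _ fun x => abs_nonneg _)
  have hG1 : ∫ x, G x ∂(α : Measure E) = 1 := by
    have h1 : Tendsto (fun _ : ℕ => |1 - ∫ x, G x ∂(α : Measure E)|) atTop (𝓝 0) := by
      refine squeeze_zero (fun _ => abs_nonneg _) (fun n => ?_) ht0
      simpa using hset n Set.univ
    have h2 := tendsto_nhds_unique tendsto_const_nhds h1
    linarith [abs_eq_zero.1 h2]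
  set γ : Measure E := (α : Measure E).withDensity fun x => ENNReal.ofReal (G x) with hγ
  have hGm : AEMeasurable (fun x => ENNReal.ofReal (G x)) (α : Measure E) :=
    hGi.aestronglyMeasurable.aemeasurable.ennreal_ofReal
  have hγs : ∀ s : Set E, γ.real s = ∫ x in s, G x ∂(α : Measure E) := by
    intro s
    rw [measureReal_def, hγ, withDensity_apply' _ s,
      ← ofReal_integral_eq_lintegral_ofReal hGi.integrableOn (ae_restrict_of_ae hG0),
      ENNReal.toReal_ofReal]
    exact integral_nonneg_of_ae (ae_restrict_of_ae hG0)
  have hγp : IsProbabilityMeasure γ := by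
    refine ⟨?_⟩
    rw [hγ, withDensity_apply _ MeasurableSet.univ, Measure.restrict_univ,
      ← ofReal_integral_eq_lintegral_ofReal hGi hG0, hG1, ENNReal.ofReal_one]
  refine ⟨⟨γ, hγp⟩, t, ht0, fun n s => ?_, ?_⟩
  · rw [ProbabilityMeasure.coe_mk, hγs]; exact hset n s
  · rw [ProbabilityMeasure.coe_mk,
      klDiv_eq_lintegral_klFun_of_ac (withDensity_absolutelyContinuous _ _)]
    have hrn : γ.rnDeriv α =ᵐ[(α : Measure E)] fun x => ENNReal.ofReal (G x) :=
      Measure.rnDeriv_withDensity₀ _ hGm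
    have hconv : ∀ᵐ x ∂(α : Measure E), ENNReal.ofReal (klFun (γ.rnDeriv α x).toReal) =
        liminf (fun k => ENNReal.ofReal (klFun (f (ns k) x))) atTop := by
      filter_upwards [hrn, hG0, hae'] with x h1 h2 h3
      rw [h1, ENNReal.toReal_ofReal h2]
      exact (((ENNReal.continuous_ofReal.comp continuous_klFun).tendsto _).comp h3).liminf_eq.symm
    rw [lintegral_congr_ae hconv]
    refine (lintegral_liminf_le fun k => ?_).trans ?_
    · exact (measurable_klFun.comp (Measure.measurable_rnDeriv _ _).ennreal_toReal).ennreal_ofReal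
    · have h4 : ∀ k, ∫⁻ x, ENNReal.ofReal (klFun (f (ns k) x)) ∂(α : Measure E) ≤
          ENNReal.ofReal (c (ns k)) := by
        intro k
        rw [← klDiv_eq_lintegral_klFun_of_ac (hac (ns k)), ← ENNReal.ofReal_toReal (hfin (ns k))]
        exact ENNReal.ofReal_le_ofReal (hle _)
      refine (liminf_le_liminf (Eventually.of_forall h4)).trans_eq ?_
      exact (((ENNReal.continuous_ofReal.tendsto L).comp hc).comp hns.tendsto_atTop).liminf_eq

/-- Csiszár's argument: if midpoint-convex sets `D n` decrease to `C`, in the sense that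
total variation limits of elements of the `D n` belong to `C`, then the infimum of the relative
entropy on `D n` increases to its infimum on `C`. Near minimizers on the `D n` are Cauchy in `L¹`,
because their midpoints cannot have a much smaller entropy, and their limit is an element of `C`. -/
lemma eventually_le_klDiv {α : ProbabilityMeasure E} {C : Set (ProbabilityMeasure E)}
    {D : ℕ → Set (ProbabilityMeasure E)} (hD : Antitone D)
    (hmid : ∀ n, ∀ μ ∈ D n, ∀ ν ∈ D n, ∀ m : ProbabilityMeasure E,
      (m : Measure E) = midpointMeasure (μ : Measure E) ν → m ∈ D n)
    (hlim : ∀ (β : ℕ → ProbabilityMeasure E) (γ : ProbabilityMeasure E) (t : ℕ → ℝ),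
      (∀ n, β n ∈ D n) → Tendsto t atTop (𝓝 0) →
      (∀ n (s : Set E), |(β n : Measure E).real s - (γ : Measure E).real s| ≤ t n) → γ ∈ C)
    {H : ℝ} (hH : ∀ γ ∈ C, klDiv (γ : Measure E) α ≠ ∞ → H ≤ (klDiv (γ : Measure E) α).toReal)
    {η : ℝ} (hη : 0 < η) :
    ∀ᶠ n in atTop, ∀ β ∈ D n, klDiv (β : Measure E) α ≠ ∞ →
      H - η ≤ (klDiv (β : Measure E) α).toReal := by
  by_contra hcon
  have hex : ∀ n, ∃ β ∈ D n, klDiv (β : Measure E) α ≠ ∞ ∧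
      (klDiv (β : Measure E) α).toReal < H - η := by
    intro n
    obtain ⟨m, hm, h⟩ := frequently_atTop.1 (not_eventually.1 hcon) n
    push Not at h
    obtain ⟨β, h1, h2, h3⟩ := h
    exact ⟨β, hD hm h1, h2, h3⟩
  set V : ℕ → Set ℝ := fun n =>
    {r | ∃ β ∈ D n, klDiv (β : Measure E) α ≠ ∞ ∧ r = (klDiv (β : Measure E) α).toReal} with hV
  have hVne : ∀ n, (V n).Nonempty := fun n => by
    obtain ⟨β, h1, h2, -⟩ := hex n
    exact ⟨_, β, h1, h2, rfl⟩
  have hVbdd : ∀ n, BddBelow (V n) := fun n => by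
    refine ⟨0, ?_⟩
    rintro r ⟨β, -, -, rfl⟩
    exact ENNReal.toReal_nonneg
  set h : ℕ → ℝ := fun n => sInf (V n) with hh
  have hmono : Monotone h := by
    intro n m hnm
    refine csInf_le_csInf (hVbdd n) (hVne m) ?_
    rintro r ⟨β, h1, h2, rfl⟩
    exact ⟨β, hD hnm h1, h2, rfl⟩
  have hub : ∀ n, h n ≤ H - η := by
    intro n
    obtain ⟨β, h1, h2, h3⟩ := hex n
    exact (csInf_le (hVbdd n) ⟨β, h1, h2, rfl⟩).trans h3.le
  have hbdd : BddAbove (Set.range h) := ⟨H - η, by rintro _ ⟨n, rfl⟩; exact hub n⟩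
  set L := ⨆ n, h n with hL
  have hLle : ∀ n, h n ≤ L := fun n => le_ciSup hbdd n
  have hLub : L ≤ H - η := ciSup_le hub
  have hL0 : Tendsto h atTop (𝓝 L) := tendsto_atTop_ciSup hmono hbdd
  have hnear : ∀ n : ℕ, ∃ β ∈ D n, klDiv (β : Measure E) α ≠ ∞ ∧
      (klDiv (β : Measure E) α).toReal < h n + 1 / ((n : ℝ) + 1) := by
    intro n
    have hpos : (0 : ℝ) < 1 / ((n : ℝ) + 1) := by positivity
    obtain ⟨r, ⟨β, h1, h2, rfl⟩, h3⟩ := exists_lt_of_csInf_lt (hVne n)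
      (lt_add_of_pos_right (sInf (V n)) hpos)
    exact ⟨β, h1, h2, h3⟩
  choose β hβD hβfin hβle using hnear
  have hone : Tendsto (fun n : ℕ => 1 / ((n : ℝ) + 1)) atTop (𝓝 0) :=
    tendsto_one_div_add_atTop_nhds_zero_nat
  set g : ℕ → ℝ := fun n => 2 * (L - h n) + 2 * (1 / ((n : ℝ) + 1)) with hg
  have hgpos : ∀ n, 0 < g n := fun n => by
    have : (0 : ℝ) < 1 / ((n : ℝ) + 1) := by positivity
    have := hLle n
    simp only [hg]; linarith
  have hg0 : Tendsto (fun n => 3 * √(g n)) atTop (𝓝 0) := by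
    have h1 : Tendsto g atTop (𝓝 0) := by
      have := ((hL0.const_sub L).const_mul 2).add (hone.const_mul 2)
      simpa [hg] using this
    have := ((Real.continuous_sqrt.tendsto 0).comp h1).const_mul 3
    simpa using this
  have hcauchy : ∀ n m N, N ≤ n → N ≤ m → ∫ x, |((β n : Measure E).rnDeriv α x).toReal -
      ((β m : Measure E).rnDeriv α x).toReal| ∂(α : Measure E) ≤ 3 * √(g N) := by
    intro n m N hn hm
    refine integral_abs_rnDeriv_sub_le (hβfin n) (hβfin m) (Real.sqrt_pos.2 (hgpos N)) ?_
    rw [Real.sq_sqrt (hgpos N).le]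
    have hmem : (⟨midpointMeasure (β n : Measure E) (β m), inferInstance⟩ : ProbabilityMeasure E)
        ∈ D N := hmid N _ (hD hn (hβD n)) _ (hD hm (hβD m)) _ rfl
    have h1 : h N ≤ (klDiv (midpointMeasure (β n : Measure E) (β m)) α).toReal :=
      csInf_le (hVbdd N) ⟨_, hmem, klDiv_midpointMeasure_ne_top (hβfin n) (hβfin m), rfl⟩
    have h2 : 1 / ((n : ℝ) + 1) ≤ 1 / ((N : ℝ) + 1) := Nat.one_div_le_one_div hn
    have h3 : 1 / ((m : ℝ) + 1) ≤ 1 / ((N : ℝ) + 1) := Nat.one_div_le_one_div hm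
    have := hβle n
    have := hβle m
    have := hLle n
    have := hLle m
    simp only [hg]
    linarith
  have hc : Tendsto (fun n : ℕ => h n + 1 / ((n : ℝ) + 1)) atTop (𝓝 L) := by
    simpa using hL0.add hone
  obtain ⟨γ, t, ht, hts, hγ⟩ := exists_limit_of_cauchy hβfin hg0 hcauchy hc fun n => (hβle n).le
  have hγC : γ ∈ C := hlim β γ t hβD ht hts
  have hL00 : 0 ≤ L := ge_of_tendsto' hc fun n => ENNReal.toReal_nonneg.trans (hβle n).le
  have h1 := hH γ hγC (ne_top_of_le_ne_top ENNReal.ofReal_ne_top hγ)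
  have h2 := ENNReal.toReal_le_of_le_ofReal hL00 hγ
  linarith

end NearMinimizers

/-! ### The Prohorov and Fortet-Mourier distances -/

section Distances

variable {E : Type*} [MeasurableSpace E] [PseudoMetricSpace E] [OpensMeasurableSpace E]

/-- The properties of the Prohorov and Fortet-Mourier distances used in the argument: a
pseudometric dominated by (twice) the Prohorov metric, with convex balls, and for which narrowly
closed sets are closed. -/
structure AdmissibleDist (d : ProbabilityMeasure E → ProbabilityMeasure E → ℝ) : Prop where
  nonneg : ∀ μ ν, 0 ≤ d μ ν
  comm : ∀ μ ν, d μ ν = d ν μ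
  triangle : ∀ μ ν κ, d μ κ ≤ d μ ν + d ν κ
  le_prohorov : ∀ μ ν, d μ ν ≤ 2 * prohorovDist μ ν
  convex : ∀ (a b : ℝ≥0), a + b = 1 → ∀ μ₁ μ₂ ν₁ ν₂ μ ν : ProbabilityMeasure E,
    (μ : Measure E) = a • (μ₁ : Measure E) + b • (μ₂ : Measure E) →
    (ν : Measure E) = a • (ν₁ : Measure E) + b • (ν₂ : Measure E) →
    ∀ r, d μ₁ ν₁ ≤ r → d μ₂ ν₂ ≤ r → d μ ν ≤ r
  mem_of_isClosed : ∀ (C : Set (ProbabilityMeasure E)), IsClosed C → ∀ ν,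
    (∀ ε > 0, ∃ μ ∈ C, d μ ν < ε) → ν ∈ C

omit [OpensMeasurableSpace E] in
lemma prohorovDist_nonneg (μ ν : ProbabilityMeasure E) : 0 ≤ prohorovDist μ ν :=
  ENNReal.toReal_nonneg

lemma prohorovDist_le_of_forall {μ ν : ProbabilityMeasure E} {δ : ℝ} (hδ : 0 ≤ δ)
    (h : ∀ ε B, δ < ε → MeasurableSet B → (μ : Measure E).real B ≤
      (ν : Measure E).real (Metric.thickening ε B) + ε) : prohorovDist μ ν ≤ δ := by
  refine levyProkhorovDist_le_of_forall_le _ _ hδ fun ε B hε hB => ?_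
  have := ENNReal.ofReal_le_ofReal (h ε B hε hB)
  rwa [ENNReal.ofReal_add measureReal_nonneg (hδ.trans hε.le), ofReal_measureReal,
    ofReal_measureReal] at this

omit [OpensMeasurableSpace E] in
lemma edist_lt_ofReal_of_prohorovDist_lt {μ ν : ProbabilityMeasure E} {ε : ℝ}
    (h : prohorovDist μ ν < ε) :
    levyProkhorovEDist (μ : Measure E) ν < ENNReal.ofReal ε :=
  (ENNReal.lt_ofReal_iff_toReal_lt (levyProkhorovEDist_ne_top _ _)).2 h

omit [OpensMeasurableSpace E] in
lemma measureReal_le_of_prohorovDist_lt {μ ν : ProbabilityMeasure E} {ε : ℝ}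
    (h : prohorovDist μ ν < ε) {B : Set E} (hB : MeasurableSet B) :
    (μ : Measure E).real B ≤ (ν : Measure E).real (Metric.thickening ε B) + ε := by
  have hε : 0 ≤ ε := (prohorovDist_nonneg μ ν).trans h.le
  have h1 := left_measure_le_of_levyProkhorovEDist_lt (edist_lt_ofReal_of_prohorovDist_lt h) hB
  rw [ENNReal.toReal_ofReal hε] at h1
  have h2 := ENNReal.toReal_mono (by finiteness) h1
  rwa [ENNReal.toReal_add (by finiteness) (by finiteness), ENNReal.toReal_ofReal hε] at h2

omit [PseudoMetricSpace E] [OpensMeasurableSpace E] in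
/-- A sequence of elements of `C` at distance less than `1 / (n + 1)`. -/
lemma exists_seq_of_forall_lt {d : ProbabilityMeasure E → ProbabilityMeasure E → ℝ}
    (hd0 : ∀ μ ν, 0 ≤ d μ ν)
    {C : Set (ProbabilityMeasure E)} {ν : ProbabilityMeasure E}
    (h : ∀ ε > 0, ∃ μ ∈ C, d μ ν < ε) :
    ∃ u : ℕ → ProbabilityMeasure E, (∀ n, u n ∈ C) ∧ Tendsto (fun n => d (u n) ν) atTop (𝓝 0) := by
  choose u huC hu using fun n : ℕ => h (1 / ((n : ℝ) + 1)) (by positivity)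
  exact ⟨u, huC, squeeze_zero (fun n => hd0 _ _) (fun n => (hu n).le)
    tendsto_one_div_add_atTop_nhds_zero_nat⟩

omit [PseudoMetricSpace E] [OpensMeasurableSpace E] in
lemma measureReal_combination {a b : ℝ≥0} {μ₁ μ₂ μ : ProbabilityMeasure E}
    (h : (μ : Measure E) = a • (μ₁ : Measure E) + b • (μ₂ : Measure E)) (s : Set E) :
    (μ : Measure E).real s = a * (μ₁ : Measure E).real s + b * (μ₂ : Measure E).real s := by
  rw [h, measureReal_add_apply, measureReal_nnreal_smul_apply, measureReal_nnreal_smul_apply]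

lemma admissibleDist_prohorovDist : AdmissibleDist (prohorovDist (E := E)) where
  nonneg := prohorovDist_nonneg
  comm μ ν := levyProkhorovDist_comm _ _
  triangle μ ν κ := levyProkhorovDist_triangle _ _ _
  le_prohorov μ ν := by linarith [prohorovDist_nonneg μ ν]
  convex a b hab μ₁ μ₂ ν₁ ν₂ μ ν hμ hν r h1 h2 := by
    refine prohorovDist_le_of_forall ((prohorovDist_nonneg _ _).trans h1) fun ε B hε hB => ?_
    have e1 := measureReal_le_of_prohorovDist_lt (h1.trans_lt hε) hB
    have e2 := measureReal_le_of_prohorovDist_lt (h2.trans_lt hε) hB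
    have hab' : (a : ℝ) + b = 1 := by exact_mod_cast hab
    rw [measureReal_combination hμ, measureReal_combination hν]
    nlinarith [mul_le_mul_of_nonneg_left e1 a.2, mul_le_mul_of_nonneg_left e2 b.2,
      congrArg (· * ε) hab']
  mem_of_isClosed C hC ν h := by
    obtain ⟨u, huC, hu⟩ := exists_seq_of_forall_lt prohorovDist_nonneg h
    have h1 : Tendsto (fun n => LevyProkhorov.ofMeasure (u n)) atTop
        (𝓝 (LevyProkhorov.ofMeasure ν)) := tendsto_iff_dist_tendsto_zero.2 hu
    exact hC.mem_of_tendsto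
      ((LevyProkhorov.continuous_toMeasure_probabilityMeasure.tendsto _).comp h1)
      (Eventually.of_forall huC)

section FortetMourier

lemma integrable_of_abs_le {f : E → ℝ} {M : ℝ} {L : ℝ≥0} (hM : ∀ x, |f x| ≤ M)
    (hL : LipschitzWith L f) (μ : Measure E) [IsFiniteMeasure μ] : Integrable f μ :=
  (integrable_const M).mono' hL.continuous.measurable.aestronglyMeasurable (ae_of_all _ hM)

omit [PseudoMetricSpace E] [OpensMeasurableSpace E] in
lemma abs_integral_le_of_abs_le {f : E → ℝ} {M : ℝ} (hM : ∀ x, |f x| ≤ M)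
    (μ : ProbabilityMeasure E) : |∫ x, f x ∂(μ : Measure E)| ≤ M := by
  have := norm_integral_le_of_norm_le_const (μ := (μ : Measure E)) (f := f) (C := M)
    (ae_of_all _ hM)
  simpa using this

omit [OpensMeasurableSpace E] in
lemma fortetMourierDist_bddAbove (μ ν : ProbabilityMeasure E) :
    BddAbove {r : ℝ | ∃ (f : E → ℝ) (M L : ℝ≥0), (∀ x, |f x| ≤ M) ∧ LipschitzWith L f ∧
      M + L ≤ 1 ∧ r = ∫ x, f x ∂(μ : Measure E) - ∫ x, f x ∂(ν : Measure E)} := by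
  refine ⟨2, ?_⟩
  rintro r ⟨f, M, L, hM, hL, hML, rfl⟩
  have h1 := abs_le.1 (abs_integral_le_of_abs_le hM μ)
  have h2 := abs_le.1 (abs_integral_le_of_abs_le hM ν)
  have hM1 : (M : ℝ) + L ≤ 1 := by exact_mod_cast hML
  linarith [L.2, h1.2, h2.1, L.coe_nonneg]

omit [OpensMeasurableSpace E] in
lemma le_fortetMourierDist (μ ν : ProbabilityMeasure E) {f : E → ℝ} {M L : ℝ≥0}
    (hM : ∀ x, |f x| ≤ M) (hL : LipschitzWith L f) (hML : M + L ≤ 1) :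
    ∫ x, f x ∂(μ : Measure E) - ∫ x, f x ∂(ν : Measure E) ≤ fortetMourierDist μ ν :=
  le_csSup (fortetMourierDist_bddAbove μ ν) ⟨f, M, L, hM, hL, hML, rfl⟩

omit [OpensMeasurableSpace E] in
lemma fortetMourierDist_le {μ ν : ProbabilityMeasure E} {r : ℝ}
    (h : ∀ (f : E → ℝ) (M L : ℝ≥0), (∀ x, |f x| ≤ M) → LipschitzWith L f → M + L ≤ 1 →
      ∫ x, f x ∂(μ : Measure E) - ∫ x, f x ∂(ν : Measure E) ≤ r) :
    fortetMourierDist μ ν ≤ r := by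
  refine csSup_le ⟨0, 0, 0, 0, by simp, LipschitzWith.const 0, by simp, by simp⟩ ?_
  rintro _ ⟨f, M, L, hM, hL, hML, rfl⟩
  exact h f M L hM hL hML

omit [OpensMeasurableSpace E] in
lemma fortetMourierDist_nonneg (μ ν : ProbabilityMeasure E) : 0 ≤ fortetMourierDist μ ν := by
  have := le_fortetMourierDist μ ν (f := fun _ => 0) (M := 0) (L := 0) (by simp)
    (LipschitzWith.const 0) (by simp)
  simpa using this

/-- Comparison of the Fortet-Mourier and Prohorov distances, by the layer cake formula: for
`ε > prohorovDist μ ν`, the `ε`-thickening of `{t ≤ f}` is contained in `{t ≤ f + L ε}`. -/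
lemma fortetMourierDist_le_two_mul_prohorovDist (μ ν : ProbabilityMeasure E) :
    fortetMourierDist μ ν ≤ 2 * prohorovDist μ ν := by
  refine fortetMourierDist_le fun f M L hM hL hML => ?_
  have hML' : (M : ℝ) + L ≤ 1 := by exact_mod_cast hML
  rw [← sub_nonneg]
  refine le_of_forall_pos_le_add fun η hη => ?_
  set ε := prohorovDist μ ν + η / 2 with hε
  have hεpos : 0 < ε := by have := prohorovDist_nonneg μ ν; positivity
  have hlt : prohorovDist μ ν < ε := by rw [hε]; linarith
  -- shift `f` to make it nonnegative
  let g : BoundedContinuousFunction E ℝ := BoundedContinuousFunction.ofNormedAddCommGroup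
    (fun x => f x + M) (hL.continuous.add continuous_const) (2 * M) fun x => by
      have := abs_le.1 (hM x)
      rw [Real.norm_eq_abs, abs_le]
      constructor <;> linarith [M.coe_nonneg]
  let g' : BoundedContinuousFunction E ℝ := g + BoundedContinuousFunction.const E (L * ε)
  have hg : ∀ x, g x = f x + M := fun x => rfl
  have hg' : ∀ x, g' x = f x + M + L * ε := fun x => rfl
  have hLε : 0 ≤ (L : ℝ) * ε := mul_nonneg L.2 hεpos.le
  have hg0 : ∀ x, 0 ≤ g x := fun x => by have := (abs_le.1 (hM x)).1; rw [hg]; linarith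
  have hg'0 : ∀ x, 0 ≤ g' x := fun x => by rw [hg']; have := hg0 x; rw [hg] at this; linarith
  have hgn : ‖g‖ ≤ 2 * M :=
    BoundedContinuousFunction.norm_ofNormedAddCommGroup_le _ (by positivity) _
  have hgg' : ‖g‖ ≤ ‖g'‖ := by
    refine (BoundedContinuousFunction.norm_le (norm_nonneg _)).2 fun x => ?_
    have h1 := g'.norm_coe_le_norm x
    rw [Real.norm_of_nonneg (hg'0 x)] at h1
    rw [Real.norm_of_nonneg (hg0 x)]
    rw [hg'] at h1
    rw [hg]; linarith
  have h1 := BoundedContinuousFunction.integral_le_of_levyProkhorovEDist_lt (μ : Measure E) ν hεpos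
    (edist_lt_ofReal_of_prohorovDist_lt hlt) g (ae_of_all _ hg0)
  have h2 := BoundedContinuousFunction.integral_eq_integral_meas_le g' (ν : Measure E)
    (ae_of_all _ hg'0)
  have hint : IntegrableOn (fun t => (ν : Measure E).real {a | t ≤ g' a}) (Set.Ioc 0 ‖g'‖) := by
    refine Measure.integrableOn_of_bounded (M := 1) measure_Ioc_lt_top.ne ?_ ?_
    · refine (Measurable.ennreal_toReal (Antitone.measurable ?_)).aestronglyMeasurable
      exact fun _ _ hst => measure_mono fun _ h => hst.trans h
    · refine Eventually.of_forall fun t => ?_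
      rw [Real.norm_of_nonneg measureReal_nonneg]
      exact measureReal_le_one
  have h3 : ∫ t in Set.Ioc 0 ‖g‖, (ν : Measure E).real (Metric.thickening ε {a | t ≤ g a}) ≤
      ∫ x, g' x ∂(ν : Measure E) := by
    rw [h2]
    refine le_trans ?_ (setIntegral_mono_set hint (ae_of_all _ fun t => measureReal_nonneg)
      (Set.Ioc_subset_Ioc_right hgg').eventuallyLE)
    refine integral_mono_of_nonneg (ae_of_all _ fun t => measureReal_nonneg)
      (hint.mono_set (Set.Ioc_subset_Ioc_right hgg')) (ae_of_all _ fun t => ?_)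
    refine measureReal_mono fun x hx => ?_
    obtain ⟨y, hy, hxy⟩ := Metric.mem_thickening_iff.1 hx
    have h4 := hL.dist_le_mul y x
    rw [Real.dist_eq, dist_comm] at h4
    have h5 : (L : ℝ) * dist x y ≤ L * ε := mul_le_mul_of_nonneg_left hxy.le L.2
    have h6 := (abs_le.1 h4).2
    simp only [Set.mem_ofPred_eq, hg] at hy
    simp only [Set.mem_ofPred_eq, hg']
    linarith
  have i1 := integrable_of_abs_le hM hL (μ : Measure E)
  have i2 := integrable_of_abs_le hM hL (ν : Measure E)
  have e1 : ∫ x, g x ∂(μ : Measure E) = ∫ x, f x ∂(μ : Measure E) + M := by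
    simp_rw [hg]; rw [integral_add i1 (integrable_const _)]; simp
  have e2 : ∫ x, g' x ∂(ν : Measure E) = ∫ x, f x ∂(ν : Measure E) + M + L * ε := by
    simp_rw [hg', add_assoc]; rw [integral_add i2 (integrable_const _)]; simp
  have h7 : ε * ‖g‖ ≤ ε * (2 * M) := mul_le_mul_of_nonneg_left hgn hεpos.le
  nlinarith [M.coe_nonneg, L.coe_nonneg]

lemma admissibleDist_fortetMourierDist : AdmissibleDist (fortetMourierDist (E := E)) where
  nonneg := fortetMourierDist_nonneg
  comm := by
    have key : ∀ μ ν : ProbabilityMeasure E, fortetMourierDist μ ν ≤ fortetMourierDist ν μ := by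
      intro μ ν
      refine fortetMourierDist_le fun f M L hM hL hML => ?_
      have := le_fortetMourierDist ν μ (f := fun x => -f x) (M := M) (L := L)
        (by simpa using hM) hL.neg hML
      rw [integral_neg, integral_neg] at this
      linarith
    exact fun μ ν => le_antisymm (key μ ν) (key ν μ)
  triangle μ ν κ := fortetMourierDist_le fun f M L hM hL hML => by
    have h1 := le_fortetMourierDist μ ν hM hL hML
    have h2 := le_fortetMourierDist ν κ hM hL hML
    linarith
  le_prohorov := fortetMourierDist_le_two_mul_prohorovDist
  convex a b hab μ₁ μ₂ ν₁ ν₂ μ ν hμ hν r h1 h2 := fortetMourierDist_le fun f M L hM hL hML => by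
    have e1 := (le_fortetMourierDist μ₁ ν₁ hM hL hML).trans h1
    have e2 := (le_fortetMourierDist μ₂ ν₂ hM hL hML).trans h2
    have hab' : (a : ℝ) + b = 1 := by exact_mod_cast hab
    have hi := fun κ : ProbabilityMeasure E => integrable_of_abs_le hM hL (κ : Measure E)
    rw [hμ, hν, integral_add_measure (hi _).smul_measure_nnreal (hi _).smul_measure_nnreal,
      integral_add_measure (hi _).smul_measure_nnreal (hi _).smul_measure_nnreal]
    simp only [integral_smul_nnreal_measure, NNReal.smul_def, smul_eq_mul]
    nlinarith [mul_le_mul_of_nonneg_left e1 a.2, mul_le_mul_of_nonneg_left e2 b.2,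
      congrArg (· * r) hab']
  mem_of_isClosed C hC ν h := by
    obtain ⟨u, huC, hu⟩ := exists_seq_of_forall_lt fortetMourierDist_nonneg h
    refine hC.mem_of_tendsto (f := u) (b := atTop) ?_ (Eventually.of_forall huC)
    rw [tendsto_iff_forall_lipschitz_integral_tendsto]
    rintro f ⟨K, hK⟩ ⟨L, hL⟩
    obtain ⟨x₀⟩ : Nonempty E := (ν : Measure E).nonempty_of_neZero
    -- normalize `f` so that it becomes admissible
    set M : ℝ≥0 := ⟨|f x₀| + |K|, by positivity⟩ with hMdef
    have hM : ∀ x, |f x| ≤ M := fun x => by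
      have h1 := hK x x₀
      rw [Real.dist_eq] at h1
      have h2 := abs_sub_abs_le_abs_sub (f x) (f x₀)
      have h3 := le_abs_self K
      change |f x| ≤ |f x₀| + |K|
      linarith
    set s : ℝ≥0 := M + L + 1 with hs
    have hs0 : s ≠ 0 := by positivity
    have hspos : (0 : ℝ) < s := by positivity
    have hL' : LipschitzWith (s⁻¹ * L) fun x => (s : ℝ)⁻¹ * f x := by
      refine LipschitzWith.of_dist_le_mul fun x y => ?_
      have h1 := hL.dist_le_mul x y
      rw [Real.dist_eq] at h1 ⊢
      rw [← mul_sub, abs_mul, abs_of_pos (inv_pos.2 hspos)]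
      push_cast
      rw [mul_assoc]
      exact mul_le_mul_of_nonneg_left h1 (inv_pos.2 hspos).le
    have hM' : ∀ x, |(s : ℝ)⁻¹ * f x| ≤ (s⁻¹ * M : ℝ≥0) := fun x => by
      rw [abs_mul, abs_of_pos (inv_pos.2 hspos)]
      push_cast
      exact mul_le_mul_of_nonneg_left (hM x) (inv_pos.2 hspos).le
    have hML : s⁻¹ * M + s⁻¹ * L ≤ 1 := by
      rw [← mul_add, inv_mul_le_iff₀ (by positivity), mul_one]
      exact le_self_add
    have hbound : ∀ n, |∫ x, f x ∂(u n : Measure E) - ∫ x, f x ∂(ν : Measure E)| ≤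
        s * fortetMourierDist (u n) ν := by
      intro n
      have h1 := le_fortetMourierDist (u n) ν hM' hL' hML
      have h2 := le_fortetMourierDist (u n) ν (f := fun x => -((s : ℝ)⁻¹ * f x))
        (by simpa using hM') hL'.neg hML
      rw [integral_neg, integral_neg] at h2
      rw [integral_const_mul, integral_const_mul] at h1 h2
      have h3 := mul_le_mul_of_nonneg_left h1 hspos.le
      have h4 := mul_le_mul_of_nonneg_left h2 hspos.le
      have h5 : (s : ℝ) * (s : ℝ)⁻¹ = 1 := mul_inv_cancel₀ hspos.ne'
      rw [abs_le]
      constructor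
      · linear_combination h4 + (∫ x, f x ∂(u n : Measure E) - ∫ x, f x ∂(ν : Measure E)) * h5
      · linear_combination h3 - (∫ x, f x ∂(u n : Measure E) - ∫ x, f x ∂(ν : Measure E)) * h5
    rw [tendsto_iff_dist_tendsto_zero]
    refine squeeze_zero (fun _ => dist_nonneg) hbound ?_
    simpa using hu.const_mul (s : ℝ)

end FortetMourier

end Distances

/-! ### Enlargements, cells and empirical measures -/

section Enlargement

variable {E : Type*} [MeasurableSpace E] [PseudoMetricSpace E] [OpensMeasurableSpace E]
  {d : ProbabilityMeasure E → ProbabilityMeasure E → ℝ} {C : Set (ProbabilityMeasure E)}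

/-- A set of probability measures which contains the convex combinations of its elements. These are
described by equalities in the cone of measures, as probability measures form no module. -/
def ClosedUnderCombinations (A : Set (ProbabilityMeasure E)) : Prop :=
  ∀ (a b : ℝ≥0), a + b = 1 → ∀ μ ∈ A, ∀ ν ∈ A, ∀ κ : ProbabilityMeasure E,
    (κ : Measure E) = a • (μ : Measure E) + b • (ν : Measure E) → κ ∈ A

omit [PseudoMetricSpace E] [OpensMeasurableSpace E] in
lemma exists_combination (a b : ℝ≥0) (hab : a + b = 1) (μ ν : ProbabilityMeasure E) :
    ∃ κ : ProbabilityMeasure E, (κ : Measure E) = a • (μ : Measure E) + b • (ν : Measure E) := by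
  refine ⟨⟨a • (μ : Measure E) + b • (ν : Measure E), ⟨?_⟩⟩, rfl⟩
  simp only [Measure.add_apply, Measure.smul_apply, measure_univ, ENNReal.smul_def, smul_eq_mul,
    mul_one]
  exact_mod_cast hab

omit [PseudoMetricSpace E] [OpensMeasurableSpace E] in
lemma IsConvexSet.closedUnderCombinations (hC : IsConvexSet C) : ClosedUnderCombinations C := by
  intro a b hab μ hμ ν hν κ hκ
  obtain ⟨κ', hκ', h⟩ := hC (Set.mem_image_of_mem _ hμ) (Set.mem_image_of_mem _ hν)
    (zero_le (a := a)) (zero_le (a := b)) hab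
  have : κ' = κ := Subtype.ext (h.trans hκ.symm)
  exact this ▸ hκ'

lemma mem_enlargement_iff (hd : AdmissibleDist d) (hC : C.Nonempty) {ε : ℝ}
    {ν : ProbabilityMeasure E} :
    ν ∈ enlargement d C ε ↔ ∀ r, ε < r → ∃ μ ∈ C, d μ ν < r := by
  have : Nonempty C := hC.to_subtype
  have hbdd : BddBelow (Set.range fun μ : C => d (μ : ProbabilityMeasure E) ν) :=
    ⟨0, by rintro _ ⟨μ, rfl⟩; exact hd.nonneg _ _⟩
  constructor
  · intro h r hr
    obtain ⟨μ, hμ⟩ := exists_lt_of_ciInf_lt (lt_of_le_of_lt h hr)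
    exact ⟨μ, μ.2, hμ⟩
  · intro h
    refine le_of_forall_gt_imp_ge_of_dense (α := ℝ) fun r hr => ?_
    obtain ⟨μ, hμC, hμ⟩ := h r hr
    exact (ciInf_le hbdd ⟨μ, hμC⟩).trans hμ.le

omit [PseudoMetricSpace E] [OpensMeasurableSpace E] in
lemma enlargement_mono {ε ε' : ℝ} (h : ε ≤ ε') : enlargement d C ε ⊆ enlargement d C ε' :=
  fun _ hν => le_trans hν h

lemma mem_enlargement_of_le (hd : AdmissibleDist d) {ε : ℝ} {μ ν : ProbabilityMeasure E}
    (hμ : μ ∈ C) (h : d μ ν ≤ ε) : ν ∈ enlargement d C ε :=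
  (mem_enlargement_iff hd ⟨μ, hμ⟩).2 fun _ hr => ⟨μ, hμ, h.trans_lt hr⟩

lemma closedUnderCombinations_enlargement (hd : AdmissibleDist d) (hne : C.Nonempty)
    (hC : ClosedUnderCombinations C) (ε : ℝ) : ClosedUnderCombinations (enlargement d C ε) := by
  intro a b hab μ hμ ν hν κ hκ
  rw [mem_enlargement_iff hd hne] at hμ hν ⊢
  intro r hr
  obtain ⟨r', hr', hr'r⟩ := exists_between hr
  obtain ⟨μ', hμ'C, hμ'⟩ := hμ r' hr'
  obtain ⟨ν', hν'C, hν'⟩ := hν r' hr'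
  obtain ⟨κ', hκ'⟩ := exists_combination a b hab μ' ν'
  exact ⟨κ', hC a b hab μ' hμ'C ν' hν'C κ' hκ',
    (hd.convex a b hab μ' ν' μ ν κ' κ hκ' hκ r' hμ'.le hν'.le).trans_lt hr'r⟩

lemma mem_enlargement_of_forall_prohorovDist (hd : AdmissibleDist d) (hne : C.Nonempty) {ε : ℝ}
    {ν : ProbabilityMeasure E}
    (h : ∀ η > 0, ∃ ν' ∈ enlargement d C ε, prohorovDist ν' ν ≤ η) : ν ∈ enlargement d C ε := by
  rw [mem_enlargement_iff hd hne]
  intro r hr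
  obtain ⟨ν', hν', h1⟩ := h ((r - ε) / 4) (by linarith)
  obtain ⟨μ, hμ, h2⟩ := (mem_enlargement_iff hd hne).1 hν' (ε + (r - ε) / 2) (by linarith)
  refine ⟨μ, hμ, ?_⟩
  have h3 := hd.triangle μ ν' ν
  have h4 := hd.le_prohorov ν' ν
  linarith

omit [PseudoMetricSpace E] [OpensMeasurableSpace E] in
lemma midpoint_mem {A : Set (ProbabilityMeasure E)} (hA : ClosedUnderCombinations A)
    {μ ν m : ProbabilityMeasure E} (hμ : μ ∈ A) (hν : ν ∈ A)
    (hm : (m : Measure E) = midpointMeasure (μ : Measure E) ν) : m ∈ A := by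
  refine hA 2⁻¹ 2⁻¹ ?_ μ hμ ν hν m hm
  rw [← two_mul]; exact mul_inv_cancel₀ two_ne_zero

lemma prohorovDist_le_of_measureReal {μ ν : ProbabilityMeasure E} {t : ℝ}
    (h : ∀ s, |(μ : Measure E).real s - (ν : Measure E).real s| ≤ t) : prohorovDist μ ν ≤ t := by
  have ht : 0 ≤ t := (abs_nonneg _).trans (h ∅)
  refine prohorovDist_le_of_forall ht fun ε B hε hB => ?_
  have h1 := (abs_le.1 (h B)).2
  have h2 : (ν : Measure E).real B ≤ (ν : Measure E).real (Metric.thickening ε B) :=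
    measureReal_mono (Metric.self_subset_thickening (ht.trans_lt hε) B)
  linarith

/-- Total variation limits of elements of shrinking enlargements of a closed set `C` lie in `C`. -/
lemma mem_of_tendsto_enlargement (hd : AdmissibleDist d) (hC : IsClosed C) (hne : C.Nonempty)
    {ε : ℕ → ℝ} (hε : Tendsto ε atTop (𝓝 0)) {β : ℕ → ProbabilityMeasure E}
    {γ : ProbabilityMeasure E} {t : ℕ → ℝ} (hβ : ∀ n, β n ∈ enlargement d C (ε n))
    (ht : Tendsto t atTop (𝓝 0))
    (h : ∀ n s, |(β n : Measure E).real s - (γ : Measure E).real s| ≤ t n) : γ ∈ C := by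
  refine hd.mem_of_isClosed C hC γ fun r hr => ?_
  have h1 : ∀ᶠ n in atTop, ε n < r / 2 := hε.eventually_lt_const (by linarith)
  have h2 : ∀ᶠ n in atTop, t n < r / 4 := ht.eventually_lt_const (by linarith)
  obtain ⟨n, hn1, hn2⟩ := (h1.and h2).exists
  obtain ⟨μ, hμ, hμ2⟩ := (mem_enlargement_iff hd hne).1 (hβ n) (r / 2) hn1
  refine ⟨μ, hμ, ?_⟩
  have h3 := hd.triangle μ (β n) γ
  have h4 := hd.le_prohorov (β n) γ
  have h5 := prohorovDist_le_of_measureReal (h n)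
  linarith

end Enlargement

section Cells

variable {E : Type*} [MeasurableSpace E] [PseudoMetricSpace E] [OpensMeasurableSpace E]
  {κ : Type*}

/-- Two probability measures which charge almost equally finitely many small cells, of almost full
mass, are close for the Prohorov metric. The cells are the fibers of `j`. -/
lemma prohorovDist_le_of_cells {μ ν : ProbabilityMeasure E} {j : E → κ}
    (hj : ∀ i, MeasurableSet (j ⁻¹' {i})) (G : Finset κ) {δ η η' : ℝ} (hδ : 0 ≤ δ)
    (hdiam : ∀ x y, j x = j y → dist x y ≤ δ)
    (hsum : ∑ i ∈ G, |(μ : Measure E).real (j ⁻¹' {i}) - (ν : Measure E).real (j ⁻¹' {i})| ≤ η)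
    (hrest : (μ : Measure E).real (j ⁻¹' (G : Set κ))ᶜ ≤ η') :
    prohorovDist μ ν ≤ max δ (η + η') := by
  classical
  refine prohorovDist_le_of_forall (hδ.trans (le_max_left _ _)) fun ε B hε hB => ?_
  have hδε : δ < ε := (le_max_left _ _).trans_lt hε
  have hηε : η + η' < ε := (le_max_right _ _).trans_lt hε
  set T := G.filter fun i => (j ⁻¹' {i} ∩ B).Nonempty with hT
  have hsub : B ⊆ (⋃ i ∈ T, j ⁻¹' {i}) ∪ (j ⁻¹' (G : Set κ))ᶜ := by
    intro x hx
    by_cases hxG : j x ∈ G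
    · left
      simp only [Set.mem_iUnion]
      exact ⟨j x, Finset.mem_filter.2 ⟨hxG, x, rfl, hx⟩, rfl⟩
    · right; exact hxG
  have hdisj : (T : Set κ).PairwiseDisjoint fun i => j ⁻¹' {i} := by
    intro i _ i' _ hii'
    exact Disjoint.preimage _ (by simpa using hii')
  have hcells : ∀ ξ : ProbabilityMeasure E, (ξ : Measure E).real (⋃ i ∈ T, j ⁻¹' {i}) =
      ∑ i ∈ T, (ξ : Measure E).real (j ⁻¹' {i}) := fun ξ =>
    measureReal_biUnion_finset hdisj fun i _ => hj i
  have h1 : (μ : Measure E).real B ≤ ∑ i ∈ T, (μ : Measure E).real (j ⁻¹' {i}) + η' := by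
    refine (measureReal_mono hsub).trans ((measureReal_union_le _ _).trans ?_)
    rw [hcells]; gcongr
  have h2 : ∑ i ∈ T, (μ : Measure E).real (j ⁻¹' {i}) ≤
      ∑ i ∈ T, (ν : Measure E).real (j ⁻¹' {i}) + η := by
    rw [← sub_le_iff_le_add', ← Finset.sum_sub_distrib]
    refine (Finset.sum_le_sum fun i _ => le_abs_self _).trans (le_trans ?_ hsum)
    exact Finset.sum_le_sum_of_subset_of_nonneg (Finset.filter_subset _ _)
      fun i _ _ => abs_nonneg _
  have h3 : ∑ i ∈ T, (ν : Measure E).real (j ⁻¹' {i}) ≤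
      (ν : Measure E).real (Metric.thickening ε B) := by
    rw [← hcells]
    refine measureReal_mono fun x hx => ?_
    simp only [Set.mem_iUnion] at hx
    obtain ⟨i, hi, hxi⟩ := hx
    obtain ⟨y, hyi, hyB⟩ := (Finset.mem_filter.1 hi).2
    exact Metric.mem_thickening_iff.2 ⟨y, hyB, (hdiam x y (hxi.trans hyi.symm)).trans_lt hδε⟩
  linarith

omit [PseudoMetricSpace E] [OpensMeasurableSpace E] in
lemma exists_finset_cells [Countable κ] (μ : Measure E) [IsProbabilityMeasure μ] {j : E → κ}
    (hj : ∀ i, MeasurableSet (j ⁻¹' {i})) {η : ℝ} (hη : 0 < η) :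
    ∃ G : Finset κ, μ.real (j ⁻¹' (G : Set κ))ᶜ ≤ η := by
  have h1 : Tendsto (fun G : Finset κ => μ (⋃ i ∈ G, j ⁻¹' {i})) atTop
      (𝓝 (μ (⋃ G : Finset κ, ⋃ i ∈ G, j ⁻¹' {i}))) :=
    tendsto_measure_iUnion_atTop fun G G' h => Set.biUnion_subset_biUnion_left h
  have h2 : (⋃ G : Finset κ, ⋃ i ∈ G, j ⁻¹' {i}) = Set.univ := by
    refine Set.eq_univ_of_forall fun x => ?_
    simp only [Set.mem_iUnion]
    exact ⟨{j x}, j x, by simp, rfl⟩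
  rw [h2, measure_univ] at h1
  have h3 := (ENNReal.tendsto_toReal ENNReal.one_ne_top).comp h1
  obtain ⟨G, hG⟩ := (h3.eventually (lt_mem_nhds (a := 1 - η) (by simp [hη]))).exists
  refine ⟨G, ?_⟩
  have h4 : j ⁻¹' (G : Set κ) = ⋃ i ∈ G, j ⁻¹' {i} := by
    ext x; simp
  rw [h4, measureReal_compl (Finset.measurableSet_biUnion _ fun i _ => hj i)]
  simp only [Function.comp_apply] at hG
  simp only [measureReal_def, measure_univ, ENNReal.toReal_one]
  linarith

end Cells

section Empirical

variable {E : Type*} [MeasurableSpace E] {n : ℕ}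

/-- The empirical probability measure of an `n`-tuple. -/
noncomputable def tupleEmpirical [NeZero n] (x : Fin n → E) : ProbabilityMeasure E :=
  ⟨(n : ℝ≥0∞)⁻¹ • ∑ i, Measure.dirac (x i), ⟨by
    simp [ENNReal.inv_mul_cancel (Nat.cast_ne_zero.2 (NeZero.ne n)) (ENNReal.natCast_ne_top n)]⟩⟩

lemma empiricalEvent_eq [NeZero n] {Ω : Type*} (X : ℕ → Ω → E) (A : Set (ProbabilityMeasure E)) :
    empiricalEvent X n A = (fun ω (i : Fin n) => X i ω) ⁻¹' {x | tupleEmpirical x ∈ A} := by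
  ext ω
  have h : ((tupleEmpirical fun i : Fin n => X i ω : ProbabilityMeasure E) : Measure E) =
      empiricalMeasure n fun i => X i ω := by
    rw [empiricalMeasure, Finset.sum_range]; rfl
  simp only [empiricalEvent, Set.mem_preimage, Set.mem_ofPred_eq]
  constructor
  · rintro ⟨ν, hν, h'⟩
    have : ν = tupleEmpirical fun i : Fin n => X i ω := Subtype.ext (h'.trans h.symm)
    exact this ▸ hν
  · exact fun h' => ⟨_, h', h⟩

lemma tupleEmpirical_real [NeZero n] (x : Fin n → E) {s : Set E} (hs : MeasurableSet s) :
    (tupleEmpirical x : Measure E).real s =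
      (n : ℝ)⁻¹ * ∑ i, s.indicator (fun _ => (1 : ℝ)) (x i) := by
  simp only [tupleEmpirical, ProbabilityMeasure.coe_mk, measureReal_def, Measure.smul_apply,
    Measure.finsetSum_apply, smul_eq_mul, ENNReal.toReal_mul, ENNReal.toReal_inv,
    ENNReal.toReal_natCast]
  rw [ENNReal.toReal_sum fun i _ => by finiteness]
  congr 1
  refine Finset.sum_congr rfl fun i _ => ?_
  rw [Measure.dirac_apply' _ hs]
  by_cases h : x i ∈ s <;> simp [h]

lemma integrable_tupleEmpirical_real [NeZero n] {s : Set E} (hs : MeasurableSet s)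
    (R : Measure (Fin n → E)) [IsFiniteMeasure R] :
    Integrable (fun x : Fin n → E => (tupleEmpirical x : Measure E).real s) R := by
  refine (integrable_const (1 : ℝ)).mono' ?_ (ae_of_all _ fun x => ?_)
  · simp only [tupleEmpirical_real _ hs]
    exact ((Finset.measurable_fun_sum _ fun l _ =>
      (measurable_const.indicator hs).comp
        (measurable_pi_apply l)).const_mul _).aestronglyMeasurable
  · rw [Real.norm_of_nonneg measureReal_nonneg]
    exact measureReal_le_one

/-- The mean of the empirical measure is the common marginal. -/
lemma integral_tupleEmpirical_real [NeZero n] {R : Measure (Fin n → E)} [IsFiniteMeasure R]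
    {Q : Measure E} (hQ : ∀ i, R.map (fun x => x i) = Q) {s : Set E} (hs : MeasurableSet s) :
    ∫ x, (tupleEmpirical x : Measure E).real s ∂(R) = Q.real s := by
  simp only [tupleEmpirical_real _ hs]
  have h1 : ∀ l : Fin n, Integrable (fun x : Fin n → E =>
      s.indicator (fun _ => (1 : ℝ)) (x l)) R := fun l =>
    (integrable_const (1 : ℝ)).mono'
      ((measurable_const.indicator hs).comp (measurable_pi_apply l)).aestronglyMeasurable
      (ae_of_all _ fun x => by
        rw [Real.norm_of_nonneg (Set.indicator_nonneg (fun _ _ => zero_le_one) _)]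
        exact Set.indicator_le_self' (fun _ _ => zero_le_one) _)
  have h2 : ∀ l : Fin n, ∫ x : Fin n → E, s.indicator (fun _ => (1 : ℝ)) (x l) ∂(R) = Q.real s := by
    intro l
    rw [← hQ l, ← integral_indicator_one hs, integral_map (measurable_pi_apply l).aemeasurable]
    · rfl
    · exact (measurable_one.indicator hs).aestronglyMeasurable
  rw [integral_const_mul, integral_finsetSum _ fun l _ => h1 l]
  simp only [h2, Finset.sum_const, Finset.card_univ, Fintype.card_fin, nsmul_eq_mul]
  rw [← mul_assoc, inv_mul_cancel₀ (Nat.cast_ne_zero.2 (NeZero.ne n)), one_mul]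

variable [PseudoMetricSpace E] [OpensMeasurableSpace E]

lemma prohorovDist_tupleEmpirical_le [NeZero n] {x y : Fin n → E} {r : ℝ} (hr : 0 ≤ r)
    (h : ∀ i, dist (x i) (y i) ≤ r) :
    prohorovDist (tupleEmpirical x) (tupleEmpirical y) ≤ r := by
  refine prohorovDist_le_of_forall hr fun ε B hε hB => ?_
  rw [tupleEmpirical_real _ hB, tupleEmpirical_real _ Metric.isOpen_thickening.measurableSet]
  have : (n : ℝ)⁻¹ * ∑ i, B.indicator (fun _ => (1 : ℝ)) (x i) ≤
      (n : ℝ)⁻¹ * ∑ i, (Metric.thickening ε B).indicator (fun _ => (1 : ℝ)) (y i) := by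
    gcongr with i
    by_cases hx : x i ∈ B
    · have : y i ∈ Metric.thickening ε B :=
        Metric.mem_thickening_iff.2 ⟨x i, hx, by rw [dist_comm]; exact (h i).trans_lt hε⟩
      simp [hx, this]
    · rw [Set.indicator_of_notMem hx]
      exact Set.indicator_nonneg (fun _ _ => zero_le_one) _
  linarith

/-- Closedness provides the measurability of the conditioning event: the empirical measure is a
`1`-Lipschitz function of the sample for the Prohorov distance. -/
lemma isClosed_tupleEmpirical_mem_enlargement [NeZero n]
    {d : ProbabilityMeasure E → ProbabilityMeasure E → ℝ} (hd : AdmissibleDist d)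
    {C : Set (ProbabilityMeasure E)} (hne : C.Nonempty) (ε : ℝ) :
    IsClosed {x : Fin n → E | tupleEmpirical x ∈ enlargement d C ε} := by
  refine isClosed_of_closure_subset fun x hx => ?_
  refine mem_enlargement_of_forall_prohorovDist hd hne fun η hη => ?_
  obtain ⟨y, hy, hxy⟩ := Metric.mem_closure_iff.1 hx η hη
  refine ⟨_, hy, prohorovDist_tupleEmpirical_le hη.le fun i => ?_⟩
  rw [dist_comm]
  exact (dist_le_pi_dist x y i).trans hxy.le

/-- The barycenter of the empirical measures, under a law `R` on `n`-tuples with equal marginals `Q`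
which makes them belong almost surely to a closed convex set `A`, belongs to `A`. The proof reduces
to finite dimension: only the masses of finitely many small cells matter up to a small error. -/
lemma marginal_mem_of_ae_tupleEmpirical_mem [NeZero n] {κ : Type*} [Countable κ]
    (hcell : ∀ δ > 0, ∃ j : E → κ, (∀ i, MeasurableSet (j ⁻¹' {i})) ∧
      ∀ x y, j x = j y → dist x y ≤ δ)
    {A : Set (ProbabilityMeasure E)} (hA : ClosedUnderCombinations A)
    (hAcl : ∀ ν, (∀ η > 0, ∃ ν' ∈ A, prohorovDist ν' ν ≤ η) → ν ∈ A)
    {R : Measure (Fin n → E)} [IsProbabilityMeasure R]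
    (hR : ∀ᵐ x ∂(R), tupleEmpirical x ∈ A) {Q : ProbabilityMeasure E}
    (hQ : ∀ i, R.map (fun x => x i) = (Q : Measure E)) : Q ∈ A := by
  refine hAcl Q fun η hη => ?_
  obtain ⟨j, hj, hdiam⟩ := hcell η hη
  obtain ⟨G, hG⟩ := exists_finset_cells (Q : Measure E) hj (half_pos hη)
  let Φ : ProbabilityMeasure E → G → ℝ := fun ν i => (ν : Measure E).real (j ⁻¹' {(i : κ)})
  have hconv : Convex ℝ (Φ '' A) := by
    rintro _ ⟨μ, hμ, rfl⟩ _ ⟨ν, hν, rfl⟩ a b ha hb hab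
    lift a to ℝ≥0 using ha
    lift b to ℝ≥0 using hb
    have hab' : a + b = 1 := by exact_mod_cast hab
    obtain ⟨κ, hκ⟩ := exists_combination a b hab' μ ν
    refine ⟨κ, hA a b hab' μ hμ ν hν κ hκ, ?_⟩
    ext i
    exact measureReal_combination hκ _
  have hint : ∀ i : G, Integrable (fun x : Fin n → E => Φ (tupleEmpirical x) i) R :=
    fun i => integrable_tupleEmpirical_real (hj i) R
  have hmem := hconv.closure.integral_mem isClosed_closure (μ := R)
    (f := fun x => Φ (tupleEmpirical x))
    (by filter_upwards [hR] with x hx using subset_closure ⟨_, hx, rfl⟩) (Integrable.of_eval hint)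
  have hΦQ : ∫ x, Φ (tupleEmpirical x) ∂(R) = Φ Q := by
    ext i
    rw [eval_integral hint]
    exact integral_tupleEmpirical_real hQ (hj i)
  rw [hΦQ] at hmem
  obtain ⟨_, ⟨ν, hν, rfl⟩, hdist⟩ := Metric.mem_closure_iff.1 hmem
    (η / (2 * (G.card + 1))) (by positivity)
  refine ⟨ν, hν, ?_⟩
  rw [admissibleDist_prohorovDist.comm]
  refine (prohorovDist_le_of_cells hj G (η := η / 2) (η' := η / 2) hη.le hdiam ?_ hG).trans ?_
  · have h3 : ∀ i ∈ G, |(Q : Measure E).real (j ⁻¹' {i}) - (ν : Measure E).real (j ⁻¹' {i})| ≤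
        η / (2 * (G.card + 1)) := by
      intro i hi
      have := (dist_le_pi_dist (Φ Q) (Φ ν) ⟨i, hi⟩).trans hdist.le
      rwa [Real.dist_eq] at this
    refine (Finset.sum_le_card_nsmul _ _ _ h3).trans ?_
    rw [nsmul_eq_mul, mul_div_assoc', div_le_div_iff₀ (by positivity) (by positivity)]
    nlinarith
  · rw [add_halves, max_self]

end Empirical

/-! ### Rate of convergence of empirical measures -/

section Cells

variable {q : ℕ}

/-- The integer coordinates of the cube of side `s`, in the grid `s ℤ^q`, to which a point
belongs. -/
noncomputable def gridCell (s : ℝ) (x : EuclideanSpace ℝ (Fin q)) : Fin q → ℤ :=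
  fun i => ⌊x i / s⌋

lemma measurableSet_gridCell (s : ℝ) (k : Fin q → ℤ) :
    MeasurableSet (gridCell s ⁻¹' {k}) := by
  have : Measurable (gridCell (q := q) s) := by
    refine measurable_pi_iff.2 fun i => ?_
    exact Int.measurable_floor.comp ((by fun_prop : Measurable fun x : EuclideanSpace ℝ (Fin q) =>
      x i / s))
  exact this (measurableSet_singleton k)

lemma dist_le_of_gridCell_eq {δ : ℝ} (hδ : 0 < δ) {x y : EuclideanSpace ℝ (Fin q)}
    (h : gridCell (δ / (√q + 1)) x = gridCell (δ / (√q + 1)) y) : dist x y ≤ δ := by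
  set s := δ / (√q + 1) with hs
  have hq : 0 ≤ √(q : ℝ) := Real.sqrt_nonneg _
  have hspos : 0 < s := by positivity
  have h1 : ∀ i, dist (x i) (y i) ≤ s := by
    intro i
    have h2 := Int.abs_sub_lt_one_of_floor_eq_floor (congrFun h i)
    rw [← sub_div, abs_div, abs_of_pos hspos, div_lt_one hspos] at h2
    exact h2.le
  rw [EuclideanSpace.dist_eq]
  have h3 : ∑ i, dist (x i) (y i) ^ 2 ≤ q * s ^ 2 := by
    refine (Finset.sum_le_card_nsmul _ _ (s ^ 2) fun i _ =>
      pow_le_pow_left₀ dist_nonneg (h1 i) 2).trans ?_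
    simp
  refine (Real.sqrt_le_sqrt h3).trans ?_
  rw [Real.sqrt_mul (Nat.cast_nonneg q), Real.sqrt_sq hspos.le, hs, mul_div_assoc',
    div_le_iff₀ (by positivity)]
  nlinarith

lemma volume_gridCell {s : ℝ} (hs : 0 < s) (k : Fin q → ℤ) :
    volume.real (gridCell s ⁻¹' {k}) = s ^ q := by
  have h : gridCell s ⁻¹' {k} = (fun x : EuclideanSpace ℝ (Fin q) => WithLp.ofLp x) ⁻¹'
      (Set.univ.pi fun i => Set.Ico (k i * s) ((k i + 1) * s)) := by
    ext x
    simp only [Set.mem_preimage, Set.mem_singleton_iff, Set.mem_pi, Set.mem_univ, true_implies,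
      Set.mem_Ico, gridCell, funext_iff, Int.floor_eq_iff, le_div_iff₀ hs, div_lt_iff₀ hs]
  rw [measureReal_def, h, (PiLp.volume_preserving_ofLp (Fin q)).measure_preimage
    (MeasurableSet.univ_pi fun i => measurableSet_Ico).nullMeasurableSet, Real.volume_pi_Ico]
  rw [ENNReal.toReal_prod]
  have : ∀ i : Fin q, (ENNReal.ofReal ((k i + 1) * s - k i * s)).toReal = s := fun i => by
    rw [ENNReal.toReal_ofReal (by linarith)]; ring
  simp [this]

lemma integrable_one_add_norm_rpow {a : ℝ} (ha : 0 ≤ a) {E : Type*} [NormedAddCommGroup E]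
    [MeasurableSpace E] [BorelSpace E] {μ : Measure E} [IsFiniteMeasure μ]
    (h : Integrable (fun x => ‖x‖ ^ a) μ) : Integrable (fun x => (1 + ‖x‖) ^ a) μ := by
  refine (((integrable_const (1 : ℝ)).add h).const_mul (2 ^ a)).mono'
    (Measurable.aestronglyMeasurable (by fun_prop)) (ae_of_all _ fun x => ?_)
  have hx := norm_nonneg x
  rw [Real.norm_of_nonneg (by positivity), Pi.add_apply]
  have h1 : (1 + ‖x‖) ^ a ≤ (2 * max 1 ‖x‖) ^ a := by
    refine Real.rpow_le_rpow (by positivity) ?_ ha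
    linarith [le_max_left 1 ‖x‖, le_max_right 1 ‖x‖]
  rw [Real.mul_rpow (by norm_num) (by positivity)] at h1
  refine h1.trans (mul_le_mul_of_nonneg_left ?_ (by positivity))
  rcases le_total 1 ‖x‖ with h2 | h2
  · rw [max_eq_right h2]; linarith
  · rw [max_eq_left h2, Real.one_rpow]
    have : 0 ≤ ‖x‖ ^ a := by positivity
    linarith

/-- By Cauchy-Schwarz, with the weight `(1 + ‖x‖) ^ a`, the square roots of the masses of the
cells have a sum of order `s ^ (-q / 2)` at most, as soon as `μ` has a moment of order `a > q`. -/
lemma exists_sum_sqrt_gridCell_le {a : ℝ} (ha : (q : ℝ) < a)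
    {μ : Measure (EuclideanSpace ℝ (Fin q))} [IsProbabilityMeasure μ]
    (hμ : Integrable (fun x => ‖x‖ ^ a) μ) :
    ∃ K : ℝ, 0 ≤ K ∧ ∀ δ : ℝ, 0 < δ → δ ≤ 1 → ∀ G : Finset (Fin q → ℤ),
      ∑ i ∈ G, √(μ.real (gridCell (δ / (√q + 1)) ⁻¹' {i})) ≤ K * √(δ ^ q)⁻¹ := by
  have ha0 : 0 ≤ a := (Nat.cast_nonneg q).trans ha.le
  have hμ1 := integrable_one_add_norm_rpow ha0 hμ
  have hvol : Integrable (fun x : EuclideanSpace ℝ (Fin q) => (1 + ‖x‖) ^ (-a)) volume :=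
    integrable_one_add_norm (by simpa using ha)
  set V := ∫ x : EuclideanSpace ℝ (Fin q), (1 + ‖x‖) ^ (-a) with hV
  set W := ∫ x, (1 + ‖x‖) ^ a ∂μ with hW
  have hq : 0 ≤ √(q : ℝ) := Real.sqrt_nonneg _
  refine ⟨√(2 ^ a * (√q + 1) ^ q) * (√V * √W), by positivity, fun δ hδ hδ1 G => ?_⟩
  set s := δ / (√q + 1) with hs
  have hspos : 0 < s := by positivity
  set Q : (Fin q → ℤ) → Set (EuclideanSpace ℝ (Fin q)) := fun i => gridCell s ⁻¹' {i} with hQ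
  have hQm : ∀ i, MeasurableSet (Q i) := measurableSet_gridCell s
  set v : (Fin q → ℤ) → ℝ := fun i => ∫ y in Q i, (1 + ‖y‖) ^ (-a) with hv
  set w : (Fin q → ℤ) → ℝ := fun i => ∫ x in Q i, (1 + ‖x‖) ^ a ∂μ with hw
  have hv0 : ∀ i, 0 ≤ v i := fun i => integral_nonneg fun y => by positivity
  have hw0 : ∀ i, 0 ≤ w i := fun i => integral_nonneg fun y => by positivity
  have hdisj : (G : Set (Fin q → ℤ)).PairwiseDisjoint Q := by
    intro i _ i' _ hii'
    exact Disjoint.preimage _ (by simpa using hii')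
  have hvsum : ∑ i ∈ G, v i ≤ V := by
    rw [← integral_biUnion_finset G (fun i _ => hQm i) hdisj fun i _ => hvol.integrableOn]
    exact setIntegral_le_integral hvol (ae_of_all _ fun x => by positivity)
  have hwsum : ∑ i ∈ G, w i ≤ W := by
    rw [← integral_biUnion_finset G (fun i _ => hQm i) hdisj fun i _ => hμ1.integrableOn]
    exact setIntegral_le_integral hμ1 (ae_of_all _ fun x => by positivity)
  -- compare the weights at two points of the same cell
  have hcmp : ∀ i, ∀ x ∈ Q i, ∀ y ∈ Q i, 1 ≤ 2 ^ a * (1 + ‖x‖) ^ a * (1 + ‖y‖) ^ (-a) := by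
    intro i x hx y hy
    have h1 : dist y x ≤ δ := dist_le_of_gridCell_eq hδ (Eq.trans hy (Eq.symm hx))
    have h2 : ‖y‖ ≤ ‖x‖ + δ := by
      rw [dist_eq_norm] at h1
      have := norm_sub_norm_le y x
      linarith
    have h3 : (1 + ‖y‖) ^ a ≤ (2 * (1 + ‖x‖)) ^ a :=
      Real.rpow_le_rpow (by positivity) (by linarith [norm_nonneg x]) ha0
    rw [Real.mul_rpow (by norm_num) (by positivity)] at h3
    rw [Real.rpow_neg (by positivity), ← div_eq_mul_inv, one_le_div (by positivity)]
    exact h3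
  have hmul : ∀ i, μ.real (Q i) * s ^ q ≤ 2 ^ a * (v i * w i) := by
    intro i
    have hvolfin : volume (Q i) ≠ ∞ := by
      intro htop
      have := volume_gridCell hspos i
      rw [measureReal_def, htop, ENNReal.toReal_top] at this
      exact (pow_pos hspos q).ne this
    have h1 : ∀ x ∈ Q i, s ^ q ≤ 2 ^ a * v i * (1 + ‖x‖) ^ a := by
      intro x hx
      have h2 : ∫ y in Q i, (1 : ℝ) ≤ ∫ y in Q i, 2 ^ a * (1 + ‖x‖) ^ a * (1 + ‖y‖) ^ (-a) :=
        setIntegral_mono_on (integrableOn_const hvolfin) (hvol.integrableOn.const_mul _) (hQm i)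
          fun y hy => hcmp i x hx y hy
      rw [integral_const_mul, setIntegral_const, smul_eq_mul, mul_one,
        volume_gridCell hspos i] at h2
      refine h2.trans_eq ?_
      simp only [hv]; ring
    have h3 : ∫ x in Q i, s ^ q ∂μ ≤ ∫ x in Q i, 2 ^ a * v i * (1 + ‖x‖) ^ a ∂μ :=
      setIntegral_mono_on (integrableOn_const (measure_ne_top _ _))
        (hμ1.integrableOn.const_mul _) (hQm i) h1
    rw [integral_const_mul, setIntegral_const, smul_eq_mul] at h3
    refine h3.trans_eq ?_
    simp only [hw]; ring
  have hsqrt : ∀ i, √(μ.real (Q i)) ≤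
      √(2 ^ a * (√q + 1) ^ q) * √(δ ^ q)⁻¹ * (√(v i) * √(w i)) := by
    intro i
    rw [← Real.sqrt_mul (hv0 i), ← Real.sqrt_mul (by positivity), ← Real.sqrt_mul (by positivity)]
    refine Real.sqrt_le_sqrt ?_
    have h1 := hmul i
    rw [hs, div_pow] at h1
    have h2 : 2 ^ a * (√q + 1) ^ q * (δ ^ q)⁻¹ * (v i * w i) =
        2 ^ a * (v i * w i) / (δ ^ q / (√q + 1) ^ q) := by
      field_simp
    rw [h2, le_div_iff₀ (by positivity)]
    exact h1
  calc ∑ i ∈ G, √(μ.real (Q i))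
      ≤ ∑ i ∈ G, √(2 ^ a * (√q + 1) ^ q) * √(δ ^ q)⁻¹ * (√(v i) * √(w i)) :=
        Finset.sum_le_sum fun i _ => hsqrt i
    _ = √(2 ^ a * (√q + 1) ^ q) * √(δ ^ q)⁻¹ * ∑ i ∈ G, √(v i) * √(w i) := by
        rw [Finset.mul_sum]
    _ ≤ √(2 ^ a * (√q + 1) ^ q) * √(δ ^ q)⁻¹ * (√V * √W) := by
        refine mul_le_mul_of_nonneg_left ?_ (by positivity)
        refine (Real.sum_sqrt_mul_sqrt_le G hv0 hw0).trans ?_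
        exact mul_le_mul (Real.sqrt_le_sqrt hvsum) (Real.sqrt_le_sqrt hwsum) (by positivity)
          (by positivity)
    _ = _ := by ring

end Cells

section Rate

lemma integral_abs_le_sqrt {Ω : Type*} [MeasurableSpace Ω] {P : Measure Ω} [IsProbabilityMeasure P]
    {Z : Ω → ℝ} (hZ : MemLp Z 2 P) : ∫ ω, |Z ω| ∂P ≤ √(∫ ω, Z ω ^ 2 ∂P) := by
  refine Real.le_sqrt_of_sq_le ?_
  have h := variance_nonneg |Z| P
  rw [variance_eq_sub hZ.abs] at h
  simp only [Pi.pow_apply, Pi.abs_apply, sq_abs] at h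
  linarith

/-- The mean error of the empirical frequency of a set is at most its standard deviation, and the
variance of an indicator is at most its mean. -/
lemma integral_abs_tupleEmpirical_sub_le {E : Type*} [MeasurableSpace E] {n : ℕ} [NeZero n]
    (μ : Measure E) [IsProbabilityMeasure μ] {s : Set E} (hs : MeasurableSet s) :
    ∫ x : Fin n → E, |μ.real s - (tupleEmpirical x : Measure E).real s| ∂(Measure.pi fun _ => μ) ≤
      √(μ.real s) * √((n : ℝ)⁻¹) := by
  have hn : (0 : ℝ) < n := Nat.cast_pos.2 (NeZero.pos n)
  set P := Measure.pi fun _ : Fin n => μ with hP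
  set g : E → ℝ := s.indicator fun _ => (1 : ℝ) with hg
  have hg01 : ∀ y, 0 ≤ g y ∧ g y ≤ 1 := fun y =>
    ⟨Set.indicator_nonneg (fun _ _ => zero_le_one) _,
      Set.indicator_le_self' (fun _ _ => zero_le_one) _⟩
  have hgL : MemLp g 2 μ := MemLp.of_bound
    (measurable_const.indicator hs).aestronglyMeasurable 1 (ae_of_all _ fun y => by
      rw [Real.norm_of_nonneg (hg01 y).1]; exact (hg01 y).2)
  have hmean : ∫ x, (tupleEmpirical x : Measure E).real s ∂P = μ.real s :=
    integral_tupleEmpirical_real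
      (fun i => (measurePreserving_eval (fun _ : Fin n => μ) i).map_eq) hs
  have hTL : MemLp (fun x : Fin n → E => (tupleEmpirical x : Measure E).real s) 2 P :=
    MemLp.of_bound (integrable_tupleEmpirical_real hs P).aestronglyMeasurable 1
      (ae_of_all _ fun x => by
        rw [Real.norm_of_nonneg measureReal_nonneg]; exact measureReal_le_one)
  have hvar : Var[fun x : Fin n → E => (tupleEmpirical x : Measure E).real s; P] ≤
      μ.real s * (n : ℝ)⁻¹ := by
    have h1 : (fun x : Fin n → E => (tupleEmpirical x : Measure E).real s) =
        fun x => (n : ℝ)⁻¹ * (∑ i : Fin n, fun x : Fin n → E => g (x i)) x := by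
      ext x
      rw [tupleEmpirical_real _ hs, Finset.sum_apply]
    have h2 : Var[g; μ] ≤ μ.real s := by
      refine (variance_le_expectation_sq (hgL.1)).trans ?_
      rw [← integral_indicator_one hs]
      refine (integral_congr_ae (ae_of_all _ fun y => ?_)).le
      by_cases hy : y ∈ s <;> simp [hg, hy]
    rw [h1, variance_const_mul, hP, variance_sum_pi fun _ => hgL]
    simp only [Finset.sum_const, Finset.card_univ, Fintype.card_fin, nsmul_eq_mul]
    calc (n : ℝ)⁻¹ ^ 2 * (n * Var[g; μ]) ≤ (n : ℝ)⁻¹ ^ 2 * (n * μ.real s) := by gcongr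
      _ = μ.real s * (n : ℝ)⁻¹ := by field_simp
  refine (integral_abs_le_sqrt ((memLp_const _).sub hTL)).trans ?_
  rw [← Real.sqrt_mul measureReal_nonneg]
  refine Real.sqrt_le_sqrt (le_trans (le_of_eq ?_) hvar)
  rw [variance_eq_integral hTL.1.aemeasurable, hmean]
  refine integral_congr_ae (ae_of_all _ fun x => ?_)
  simp only [Pi.sub_apply]
  ring

/-- Deviation of the empirical measure, for a law with a moment of order `a > q`: Markov's
inequality for the sum of the errors on the cells of a grid of diameter `r`. -/
lemma exists_measureReal_prohorovDist_le {q : ℕ} {a : ℝ} (ha : (q : ℝ) < a)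
    (μ : ProbabilityMeasure (EuclideanSpace ℝ (Fin q)))
    (hμ : Integrable (fun x => ‖x‖ ^ a) (μ : Measure (EuclideanSpace ℝ (Fin q)))) :
    ∃ K : ℝ, 0 ≤ K ∧ ∀ r : ℝ, 0 < r → r ≤ 1 → ∀ (n : ℕ) [NeZero n],
      (Measure.pi fun _ : Fin n => (μ : Measure (EuclideanSpace ℝ (Fin q)))).real
        {x | r < prohorovDist μ (tupleEmpirical x)} ≤ K * (r⁻¹ * √(r ^ q)⁻¹ * √((n : ℝ)⁻¹)) := by
  obtain ⟨K, hK0, hK⟩ := exists_sum_sqrt_gridCell_le ha hμ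
  refine ⟨2 * K, by positivity, fun r hr hr1 n hn => ?_⟩
  set P := Measure.pi fun _ : Fin n => (μ : Measure (EuclideanSpace ℝ (Fin q))) with hP
  set Q : (Fin q → ℤ) → Set (EuclideanSpace ℝ (Fin q)) :=
    fun i => gridCell (r / (√q + 1)) ⁻¹' {i} with hQ
  have hQm : ∀ i, MeasurableSet (Q i) := measurableSet_gridCell _
  obtain ⟨G, hG⟩ := exists_finset_cells (μ : Measure (EuclideanSpace ℝ (Fin q))) hQm (half_pos hr)
  set D : (Fin n → EuclideanSpace ℝ (Fin q)) → ℝ := fun x => ∑ i ∈ G,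
    |(μ : Measure _).real (Q i) - (tupleEmpirical x : Measure _).real (Q i)| with hD
  have hDi : ∀ i, Integrable (fun x : Fin n → EuclideanSpace ℝ (Fin q) =>
      |(μ : Measure _).real (Q i) - (tupleEmpirical x : Measure _).real (Q i)|) P :=
    fun i => ((integrable_const _).sub (integrable_tupleEmpirical_real (hQm i) P)).abs
  have hDint : Integrable D P := integrable_finsetSum _ fun i _ => hDi i
  have hsub : {x | r < prohorovDist μ (tupleEmpirical x)} ⊆ {x | r / 2 ≤ D x} := by
    intro x hx
    by_contra hcon
    have h1 : D x ≤ r / 2 := (not_le.1 hcon).le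
    have h2 := prohorovDist_le_of_cells hQm G hr.le (fun x y h => dist_le_of_gridCell_eq hr h) h1 hG
    rw [add_halves, max_self] at h2
    exact absurd hx (not_lt.2 h2)
  have hmarkov := mul_meas_ge_le_integral_of_nonneg
    (ae_of_all P fun x => Finset.sum_nonneg fun i _ => abs_nonneg _) hDint (r / 2)
  have hmean : ∫ x, D x ∂P ≤ K * √(r ^ q)⁻¹ * √((n : ℝ)⁻¹) := by
    rw [integral_finsetSum _ fun i _ => hDi i]
    refine (Finset.sum_le_sum fun i _ => integral_abs_tupleEmpirical_sub_le _ (hQm i)).trans ?_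
    rw [← Finset.sum_mul]
    exact mul_le_mul_of_nonneg_right (hK r hr hr1 G) (Real.sqrt_nonneg _)
  have h3 : P.real {x | r / 2 ≤ D x} ≤ 2 * r⁻¹ * (K * √(r ^ q)⁻¹ * √((n : ℝ)⁻¹)) := by
    have h4 := hmarkov.trans hmean
    rw [mul_comm, ← le_div_iff₀ (by positivity)] at h4
    refine h4.trans_eq ?_
    field_simp
  refine (measureReal_mono hsub).trans (h3.trans_eq ?_)
  ring

/-- Under a moment of order `a > q`, empirical measures converge at the rate `n ^ (-b)`,
for every `b < 1 / (2 + q)`. -/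
lemma eventually_measureReal_prohorovDist_le {q : ℕ} {a b : ℝ} (ha : (q : ℝ) < a) (hb : 0 < b)
    (hbq : b < 1 / (2 + q)) (μ : ProbabilityMeasure (EuclideanSpace ℝ (Fin q)))
    (hμ : Integrable (fun x => ‖x‖ ^ a) (μ : Measure (EuclideanSpace ℝ (Fin q))))
    {η : ℝ} (hη : 0 < η) :
    ∀ᶠ n : ℕ in atTop, ∀ [NeZero n],
      (Measure.pi fun _ : Fin n => (μ : Measure (EuclideanSpace ℝ (Fin q)))).real
        {x | 1 / (n : ℝ) ^ b < prohorovDist μ (tupleEmpirical x)} ≤ η := by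
  obtain ⟨K, hK0, hK⟩ := exists_measureReal_prohorovDist_le ha μ hμ
  have hexp : 0 < 1 / 2 - b * (1 + q / 2) := by
    rw [lt_div_iff₀ (by positivity)] at hbq
    linarith
  have hlim : Tendsto (fun n : ℕ => K * (n : ℝ) ^ (-(1 / 2 - b * (1 + q / 2)))) atTop (𝓝 0) := by
    have := ((tendsto_rpow_neg_atTop hexp).comp tendsto_natCast_atTop_atTop).const_mul K
    simpa using this
  filter_upwards [hlim.eventually_lt_const hη, eventually_ge_atTop 1] with n hn hn1 hne
  have hn0 : (0 : ℝ) < n := by exact_mod_cast hn1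
  have hn1' : (1 : ℝ) ≤ n := by exact_mod_cast hn1
  refine (hK (1 / (n : ℝ) ^ b) (by positivity) ?_ n).trans (le_trans (le_of_eq ?_) hn.le)
  · rw [div_le_one (by positivity)]
    exact Real.one_le_rpow hn1' hb.le
  · congr 1
    have h1 : (1 / (n : ℝ) ^ b)⁻¹ = (n : ℝ) ^ b := by rw [one_div, inv_inv]
    have h2 : √((1 / (n : ℝ) ^ b) ^ q)⁻¹ = (n : ℝ) ^ (b * (q / 2)) := by
      rw [one_div, inv_pow, inv_inv, Real.sqrt_eq_rpow, ← Real.rpow_natCast, ← Real.rpow_mul hn0.le,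
        ← Real.rpow_mul hn0.le]
      congr 1; ring
    have h3 : √((n : ℝ)⁻¹) = (n : ℝ) ^ (-(1 / 2) : ℝ) := by
      rw [Real.sqrt_eq_rpow, Real.rpow_neg hn0.le, Real.inv_rpow hn0.le]
    rw [h1, h2, h3, ← Real.rpow_add hn0, ← Real.rpow_add hn0]
    congr 1; ring

end Rate

/-! ### Conditioning an i.i.d. sample by a symmetric event -/

section LowerBound

variable {F : Type*} [MeasurableSpace F] {μ ρ : Measure F} [IsProbabilityMeasure μ]
  [IsProbabilityMeasure ρ]

/-- Change of measure: an event which is likely under `μ` is not too unlikely under `ρ`. This is the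
variational formula for the function `exp (c 1_S)`, bounded by `1 + exp c 1_S`. -/
lemma mul_measureReal_le_klDiv (h : klDiv μ ρ ≠ ∞) {S : Set F} (hS : MeasurableSet S) {c : ℝ}
    (hc : 0 ≤ c) : c * μ.real S ≤ (klDiv μ ρ).toReal + Real.log (1 + Real.exp c * ρ.real S) := by
  set Z := 1 + Real.exp c * ρ.real S with hZ
  have hZpos : 0 < Z := by positivity
  set g : F → ℝ := S.indicator fun _ => (1 : ℝ) with hg
  have hg0 : ∀ x, 0 ≤ g x := Set.indicator_nonneg fun _ _ => zero_le_one
  have hg1 : ∀ x, g x ≤ 1 := Set.indicator_le_self' fun _ _ => zero_le_one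
  have hgm : Measurable g := measurable_const.indicator hS
  have hgi : ∀ ν : Measure F, IsProbabilityMeasure ν → Integrable g ν := fun ν _ =>
    (integrable_const (1 : ℝ)).indicator hS
  have hgint : ∀ ν : Measure F, ∫ x, g x ∂ν = ν.real S := fun ν => integral_indicator_one hS
  have hGpos : ∀ x, 0 < (1 + Real.exp c * g x) / Z := fun x => by
    have := hg0 x; positivity
  have hGlog : ∀ x, c * g x - Real.log Z ≤ Real.log ((1 + Real.exp c * g x) / Z) := by
    intro x
    have h0 := hg0 x
    rw [Real.log_div (by positivity) hZpos.ne']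
    refine sub_le_sub_right ?_ _
    by_cases hx : x ∈ S
    · simp only [hg, Set.indicator_of_mem hx, mul_one]
      rw [Real.le_log_iff_exp_le (by positivity)]
      linarith
    · simp [hg, Set.indicator_of_notMem hx]
  have hlogm : Measurable fun x => Real.log ((1 + Real.exp c * g x) / Z) := by fun_prop
  have hlogi : Integrable (fun x => Real.log ((1 + Real.exp c * g x) / Z)) μ := by
    refine (integrable_const (|Real.log Z| + Real.exp c)).mono' hlogm.aestronglyMeasurable
      (ae_of_all _ fun x => ?_)
    have h0 := hg0 x
    have h1 := hGlog x
    have h2 : Real.log (1 + Real.exp c * g x) ≤ Real.exp c * g x := by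
      have := Real.log_le_sub_one_of_pos (x := 1 + Real.exp c * g x) (by positivity)
      linarith
    have h3 : Real.exp c * g x ≤ Real.exp c := mul_le_of_le_one_right (Real.exp_pos c).le (hg1 x)
    rw [Real.norm_eq_abs, abs_le]
    constructor
    · have := le_abs_self (Real.log Z)
      have := Real.exp_pos c
      nlinarith
    · rw [Real.log_div (by positivity) hZpos.ne']
      have := neg_abs_le (Real.log Z)
      linarith
  have hGi : Integrable (fun x => (1 + Real.exp c * g x) / Z) ρ :=
    ((integrable_const 1).add ((hgi ρ inferInstance).const_mul _)).div_const _
  have hG1 : ∫ x, (1 + Real.exp c * g x) / Z ∂ρ = 1 := by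
    rw [integral_div, integral_add (integrable_const 1) ((hgi ρ inferInstance).const_mul _),
      integral_const_mul, hgint, integral_const, probReal_univ, one_smul]
    exact div_self hZpos.ne'
  have key := integral_log_le_klDiv h (fun x => (hGpos x).le) (ae_of_all _ hGpos) hlogi hGi
  rw [hG1] at key
  have h4 : ∫ x, (c * g x - Real.log Z) ∂μ ≤ _ :=
    integral_mono (((hgi μ inferInstance).const_mul c).sub (integrable_const _)) hlogi hGlog
  rw [integral_sub ((hgi μ inferInstance).const_mul c) (integrable_const _), integral_const_mul,
    hgint, integral_const, probReal_univ, one_smul] at h4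
  linarith

/-- Events which are asymptotically certain under `μ^n` have a probability at least
`exp (-n (H(μ | ρ) + η))` under `ρ^n`. -/
lemma exists_eventually_exp_lt_pi (h : klDiv μ ρ ≠ ∞) {η : ℝ} (hη : 0 < η) :
    ∃ θ > 0, ∀ᶠ n : ℕ in atTop, ∀ S : Set (Fin n → F), MeasurableSet S →
      1 - θ ≤ (Measure.pi fun _ : Fin n => μ).real S →
      Real.exp (-(n * ((klDiv μ ρ).toReal + η))) < (Measure.pi fun _ : Fin n => ρ).real S := by
  set H := (klDiv μ ρ).toReal with hH
  have hH0 : 0 ≤ H := ENNReal.toReal_nonneg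
  -- this choice of `θ` makes `(H + η) (1 - θ) = H + η / 2`
  refine ⟨η / (2 * (H + η)), by positivity, ?_⟩
  have hlim : Tendsto (fun n : ℕ => (n : ℝ) * (η / 2)) atTop atTop :=
    tendsto_natCast_atTop_atTop.atTop_mul_const (by positivity)
  filter_upwards [hlim.eventually_gt_atTop (Real.log 2)] with n hn S hS hp
  by_contra hcon
  rw [not_lt] at hcon
  obtain ⟨hfin, heq⟩ := klDiv_pi (ι := Fin n) h
  have h1 := mul_measureReal_le_klDiv hfin hS (c := n * (H + η)) (by positivity)
  rw [heq, Fintype.card_fin] at h1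
  have h2 : Real.log (1 + Real.exp (n * (H + η)) * (Measure.pi fun _ : Fin n => ρ).real S) ≤
      Real.log 2 := by
    refine Real.log_le_log (by positivity) ?_
    have := mul_le_mul_of_nonneg_left hcon (Real.exp_pos (n * (H + η))).le
    rw [← Real.exp_add, add_neg_cancel, Real.exp_zero] at this
    linarith
  have h3 := mul_le_mul_of_nonneg_left hp (by positivity : 0 ≤ n * (H + η))
  have h4 : n * (H + η) * (1 - η / (2 * (H + η))) = n * H + n * (η / 2) := by
    have : H + η ≠ 0 := by positivity
    field_simp
    ring
  rw [h4] at h3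
  linarith

end LowerBound

section Exchangeability

variable {E : Type*} [MeasurableSpace E] {n k : ℕ}

/-- Disjoint blocks of independent variables are independent. -/
lemma iIndepFun_blocks {Ω ι κ : Type*} [MeasurableSpace Ω] {P : Measure Ω} [IsProbabilityMeasure P]
    {Y : ι × κ → Ω → E} (hY : ∀ p, Measurable (Y p)) (h : iIndepFun Y P) :
    iIndepFun (fun i ω (j : κ) => Y (i, j) ω) P := by
  have hp : ∀ p, IsProbabilityMeasure (P.map (Y p)) :=
    fun p => Measure.isProbabilityMeasure_map (hY p).aemeasurable
  have hm : ∀ i, Measurable fun ω (j : κ) => Y (i, j) ω :=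
    fun i => measurable_pi_iff.2 fun j => hY (i, j)
  rw [iIndepFun_iff_map_fun_eq_infinitePi_map (by fun_prop)]
  have h1 : ∀ i, P.map (fun ω (j : κ) => Y (i, j) ω) =
      Measure.infinitePi fun j => P.map (Y (i, j)) := fun i =>
    (iIndepFun_iff_map_fun_eq_infinitePi_map (fun j => by fun_prop)).1
      (h.precomp (g := fun j : κ => (i, j)) fun _ _ h => congrArg Prod.snd h)
  simp_rw [h1]
  rw [← Measure.infinitePi_map_curry (fun i j => P.map (Y (i, j))),
    ← (iIndepFun_iff_map_fun_eq_infinitePi_map (by fun_prop)).1 h,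
    Measure.map_map (by fun_prop) (by fun_prop)]
  rfl

lemma pi_map_comp (ρ : Measure E) [IsProbabilityMeasure ρ] {ι κ : Type*} [Fintype ι] [Fintype κ]
    {τ : κ → ι} (hτ : Function.Injective τ) :
    (Measure.pi fun _ : ι => ρ).map (fun x => x ∘ τ) = Measure.pi fun _ : κ => ρ := by
  have h := (iIndepFun_pi (μ := fun _ : ι => ρ) (X := fun _ y => y)
    fun _ => aemeasurable_id).precomp hτ
  refine (h.map_fun_eq_pi_map fun i => (measurable_pi_apply (τ i)).aemeasurable).trans ?_
  congr 1
  ext1 i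
  exact (measurePreserving_eval (fun _ : ι => ρ) (τ i)).map_eq

variable {ρ : Measure E} [IsProbabilityMeasure ρ] {S : Set (Fin n → E)}

/-- Conditionally on a symmetric event, the variables of an i.i.d. sample are exchangeable. -/
lemma cond_pi_map_comp_perm (hS : MeasurableSet S) (hsym : ∀ (σ : Equiv.Perm (Fin n)) x,
    x ∘ σ ∈ S ↔ x ∈ S) (σ : Equiv.Perm (Fin n)) :
    ((Measure.pi fun _ : Fin n => ρ)[|S]).map (fun x => x ∘ σ) =
      (Measure.pi fun _ : Fin n => ρ)[|S] := by
  have hm : Measurable fun x : Fin n → E => x ∘ σ :=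
    measurable_pi_iff.2 fun i => measurable_pi_apply (σ i)
  have hpre : (fun x : Fin n → E => x ∘ σ) ⁻¹' S = S := Set.ext fun x => hsym σ x
  rw [ProbabilityTheory.cond, Measure.map_smul]
  congr 1
  conv_lhs => rw [← hpre]
  rw [← Measure.restrict_map hm hS, pi_map_comp ρ σ.injective]

lemma cond_pi_map_comp_embedding (hS : MeasurableSet S) (hsym : ∀ (σ : Equiv.Perm (Fin n)) x,
    x ∘ σ ∈ S ↔ x ∈ S) (τ τ' : Fin k ↪ Fin n) :
    ((Measure.pi fun _ : Fin n => ρ)[|S]).map (fun x => x ∘ τ) =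
      ((Measure.pi fun _ : Fin n => ρ)[|S]).map (fun x => x ∘ τ') := by
  have htrans := Equiv.Perm.isMultiplyPretransitive (Fin n) k
  obtain ⟨σ, hσ⟩ := htrans.exists_smul_eq τ' τ
  have hτ : ∀ x : Fin n → E, x ∘ τ = (x ∘ σ) ∘ τ' := by
    intro x
    rw [← hσ]
    rfl
  have hm : Measurable fun x : Fin n → E => x ∘ σ :=
    measurable_pi_iff.2 fun i => measurable_pi_apply (σ i)
  have hm' : Measurable fun x : Fin n → E => x ∘ τ' :=
    measurable_pi_iff.2 fun i => measurable_pi_apply (τ' i)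
  conv_rhs => rw [← cond_pi_map_comp_perm hS hsym σ]
  rw [Measure.map_map hm' hm]
  simp only [hτ]
  rfl

/-- The embedding of `Fin k` as the `j`-th block of length `k` of `Fin n`. -/
def blockEmbedding (n k : ℕ) (j : Fin (n / k)) : Fin k ↪ Fin n where
  toFun i := ⟨j * k + i, by
    have h1 : (j : ℕ) * k + k ≤ n / k * k := by
      rw [← Nat.succ_mul]; exact Nat.mul_le_mul_right k j.2
    have h2 := Nat.div_mul_le_self n k
    have := i.2
    omega⟩
  inj' i i' h := by
    simp only [Fin.mk.injEq, add_right_inj] at h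
    exact Fin.ext h

lemma blockEmbedding_injective :
    Function.Injective fun p : Fin (n / k) × Fin k => blockEmbedding n k p.1 p.2 := by
  rintro ⟨j, i⟩ ⟨j', i'⟩ h'
  have h : (j : ℕ) * k + i = j' * k + i' := congrArg Fin.val h'
  have hk : 0 < k := i.pos
  have h1 : (j : ℕ) = j' := by
    have := congrArg (· / k) h
    simpa [Nat.add_div_of_dvd_right, Nat.mul_comm _ k, Nat.mul_add_div hk,
      Nat.div_eq_of_lt i.2, Nat.div_eq_of_lt i'.2] using this
  have h2 : (i : ℕ) = i' := by rw [h1] at h; omega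
  exact Prod.ext (Fin.ext h1) (Fin.ext h2)

/-- The entropy of the conditional law of `k` variables, by superadditivity over `n / k` disjoint
blocks, which have the same conditional law by exchangeability. -/
lemma klDiv_cond_pi_map_le (hS : MeasurableSet S) (hsym : ∀ (σ : Equiv.Perm (Fin n)) x,
    x ∘ σ ∈ S ↔ x ∈ S) (hpos : (Measure.pi fun _ : Fin n => ρ) S ≠ 0) (τ : Fin k ↪ Fin n) :
    klDiv (((Measure.pi fun _ : Fin n => ρ)[|S]).map fun x => x ∘ τ)
        (Measure.pi fun _ : Fin k => ρ) ≠ ∞ ∧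
      (n / k : ℕ) * (klDiv (((Measure.pi fun _ : Fin n => ρ)[|S]).map fun x => x ∘ τ)
        (Measure.pi fun _ : Fin k => ρ)).toReal ≤
          -Real.log ((Measure.pi fun _ : Fin n => ρ).real S) := by
  set P := Measure.pi fun _ : Fin n => ρ with hP
  have hprob : IsProbabilityMeasure (P[|S]) := cond_isProbabilityMeasure hpos
  obtain ⟨hfin, heq⟩ := klDiv_cond hS hpos
  have hm : ∀ τ : Fin k ↪ Fin n, Measurable fun x : Fin n → E => x ∘ τ :=
    fun τ => measurable_pi_iff.2 fun i => measurable_pi_apply (τ i)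
  refine ⟨?_, ?_⟩
  · have h1 := klDiv_map_le (P[|S]) P (hm τ)
    rw [hP, pi_map_comp ρ τ.injective] at h1
    exact ne_top_of_le_ne_top hfin h1
  · have hind :
        iIndepFun (fun (j : Fin (n / k)) (x : Fin n → E) => x ∘ blockEmbedding n k j) P := by
      have h1 := (iIndepFun_pi (μ := fun _ : Fin n => ρ) (X := fun _ y => y)
        fun _ => aemeasurable_id).precomp (blockEmbedding_injective (n := n) (k := k))
      exact iIndepFun_blocks (Y := fun p (x : Fin n → E) => x (blockEmbedding n k p.1 p.2))
        (fun p => measurable_pi_apply _) h1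
    have h2 := sum_klDiv_map_le (fun j => hm (blockEmbedding n k j)) hind hfin
    rw [← heq]
    refine le_trans (le_of_eq ?_) h2
    have h3 : ∀ j : Fin (n / k), (klDiv ((P[|S]).map fun x => x ∘ blockEmbedding n k j)
        (P.map fun x => x ∘ blockEmbedding n k j)).toReal =
        (klDiv ((P[|S]).map fun x => x ∘ τ) (Measure.pi fun _ : Fin k => ρ)).toReal := by
      intro j
      rw [hP, pi_map_comp ρ (blockEmbedding n k j).injective,
        cond_pi_map_comp_embedding hS hsym (blockEmbedding n k j) τ]
    simp [h3]

end Exchangeability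

/-! ### The conditioning principle -/

section Main

variable {q : ℕ}

lemma tupleEmpirical_comp_perm {E : Type*} [MeasurableSpace E] {n : ℕ} [NeZero n]
    (x : Fin n → E) (σ : Equiv.Perm (Fin n)) : tupleEmpirical (x ∘ σ) = tupleEmpirical x := by
  refine Subtype.ext ?_
  simp only [tupleEmpirical, Function.comp_apply]
  rw [Equiv.sum_comp σ fun i => Measure.dirac (x i)]

/-- The conditional laws, transported to the canonical product space. -/
lemma conditionalLaw_eq {E : Type*} [MeasurableSpace E] {Ω : Type*} [MeasurableSpace Ω]
    {P : Measure Ω} {X : ℕ → Ω → E} (hX : ∀ i, Measurable (X i)) (hind : iIndepFun X P)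
    {α : Measure E} (hlaw : ∀ i, P.map (X i) = α) {n k : ℕ} [NeZero n] (hk : k ≤ n)
    {A : Set (ProbabilityMeasure E)}
    (hA : MeasurableSet {x : Fin n → E | tupleEmpirical x ∈ A}) :
    P (empiricalEvent X n A) = (Measure.pi fun _ : Fin n => α) {x | tupleEmpirical x ∈ A} ∧
      conditionalLaw P X n k A = ((Measure.pi fun _ : Fin n => α)[|{x | tupleEmpirical x ∈ A}]).map
        fun x => x ∘ Fin.castLEEmb hk := by
  have hm : Measurable fun ω (i : Fin n) => X i ω := measurable_pi_iff.2 fun i => hX i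
  have hmap : P.map (fun ω (i : Fin n) => X i ω) = Measure.pi fun _ : Fin n => α := by
    have h0 : iIndepFun (fun i : Fin n => X i) P :=
      hind.precomp (g := fun i : Fin n => (i : ℕ)) Fin.val_injective
    have h := h0.map_fun_eq_pi_map fun i : Fin n => (hX (i : ℕ)).aemeasurable
    simpa only [hlaw] using h
  have hev : P (empiricalEvent X n A) =
      (Measure.pi fun _ : Fin n => α) {x | tupleEmpirical x ∈ A} := by
    rw [empiricalEvent_eq, ← hmap, Measure.map_apply hm hA]
  refine ⟨hev, ?_⟩
  have hm' : Measurable fun x : Fin n → E => x ∘ Fin.castLEEmb hk :=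
    measurable_pi_iff.2 fun i => measurable_pi_apply _
  rw [conditionalLaw, ProbabilityTheory.cond, ProbabilityTheory.cond, hev, Measure.map_smul,
    Measure.map_smul, empiricalEvent_eq, ← hmap, Measure.restrict_map hm hA,
    Measure.map_map hm' hm]
  rfl

/-- The conditioning principle, for any admissible distance: a moment of order `a > q` of the
`I`-projection suffices for all exponents `b < 1 / (2 + q)`. -/
theorem gibbsConvergence_of_moment {α αs : ProbabilityMeasure (EuclideanSpace ℝ (Fin q))}
    {C : Set (ProbabilityMeasure (EuclideanSpace ℝ (Fin q)))}
    (hCclosed : IsClosed C) (hCconvex : IsConvexSet C) (hCfinite : entropyInf C α < ∞)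
    (hαs : IsIProjection C α αs)
    {d : ProbabilityMeasure (EuclideanSpace ℝ (Fin q)) →
      ProbabilityMeasure (EuclideanSpace ℝ (Fin q)) → ℝ} (hd : AdmissibleDist d)
    {Ω : Type*} [MeasurableSpace Ω] {P : Measure Ω} [IsProbabilityMeasure P]
    {X : ℕ → Ω → EuclideanSpace ℝ (Fin q)} (hXmeas : ∀ i, Measurable (X i))
    (hXindep : iIndepFun X P)
    (hXlaw : ∀ i, P.map (X i) = (α : Measure (EuclideanSpace ℝ (Fin q))))
    {a b : ℝ} (ha : (q : ℝ) < a)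
    (hmom : Integrable (fun x => ‖x‖ ^ a) (αs : Measure (EuclideanSpace ℝ (Fin q))))
    (hb : 0 < b) (hbq : b < 1 / (2 + q)) :
    GibbsConvergence P X (fun n => enlargement d C (2 / (n : ℝ) ^ b)) αs := by
  set A : ℕ → Set (ProbabilityMeasure (EuclideanSpace ℝ (Fin q))) :=
    fun n => enlargement d C (2 / (n : ℝ) ^ b) with hA
  have hne : C.Nonempty := ⟨αs, hαs.mem⟩
  have hfin : klDiv (αs : Measure (EuclideanSpace ℝ (Fin q))) α ≠ ∞ := by
    rw [hαs.klDiv_eq]; exact hCfinite.ne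
  set H := (klDiv (αs : Measure (EuclideanSpace ℝ (Fin q))) α).toReal with hH
  have hH0 : 0 ≤ H := ENNReal.toReal_nonneg
  have hcomb : ∀ n, ClosedUnderCombinations (A n) := fun n =>
    closedUnderCombinations_enlargement hd hne hCconvex.closedUnderCombinations _
  have hSm : ∀ (n : ℕ) [NeZero n], MeasurableSet {x : Fin n → EuclideanSpace ℝ (Fin q) |
      tupleEmpirical x ∈ A n} := fun n _ =>
    (isClosed_tupleEmpirical_mem_enlargement hd hne _).measurableSet
  have hαsA : ∀ n, αs ∈ A n := fun n => mem_enlargement_of_le hd hαs.mem <| by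
    have h1 := hd.le_prohorov αs αs
    have h2 : prohorovDist αs αs = 0 := levyProkhorovDist_self _
    have h3 : 0 ≤ 2 / (n : ℝ) ^ b := by positivity
    linarith
  -- the lower bound for the probability of the conditioning events
  have hlower : ∀ η > 0, ∀ᶠ n : ℕ in atTop, ∀ [NeZero n],
      Real.exp (-(n * (H + η))) <
        (Measure.pi fun _ : Fin n => (α : Measure (EuclideanSpace ℝ (Fin q)))).real
          {x | tupleEmpirical x ∈ A n} := by
    intro η hη
    obtain ⟨θ, hθ, hev⟩ := exists_eventually_exp_lt_pi hfin hη
    filter_upwards [hev, eventually_measureReal_prohorovDist_le ha hb hbq αs hmom hθ]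
      with n h1 h2 hn
    refine h1 _ (hSm n) ?_
    have h3 := h2
    rw [sub_le_comm]
    refine le_trans ?_ h3
    have hcompl := measureReal_compl (μ := Measure.pi fun _ : Fin n =>
      (αs : Measure (EuclideanSpace ℝ (Fin q)))) (hSm n)
    rw [probReal_univ] at hcompl
    rw [← hcompl]
    refine measureReal_mono fun x hx => ?_
    by_contra hcon
    refine hx (mem_enlargement_of_le hd hαs.mem ?_)
    have h4 : prohorovDist αs (tupleEmpirical x) ≤ 1 / (n : ℝ) ^ b := not_lt.1 hcon
    have h5 := hd.le_prohorov αs (tupleEmpirical x)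
    have h6 : 2 / (n : ℝ) ^ b = 2 * (1 / (n : ℝ) ^ b) := by ring
    linarith
  -- the infima of the entropy on the enlargements converge to the infimum on `C`
  have hinf : ∀ η > 0, ∀ᶠ n : ℕ in atTop, ∀ β ∈ A n,
      klDiv (β : Measure (EuclideanSpace ℝ (Fin q))) α ≠ ∞ →
        H - η ≤ (klDiv (β : Measure (EuclideanSpace ℝ (Fin q))) α).toReal := by
    intro η hη
    have hpow : Tendsto (fun n : ℕ => 2 / (n : ℝ) ^ b) atTop (𝓝 0) :=
      ((tendsto_rpow_atTop hb).comp tendsto_natCast_atTop_atTop).const_div_atTop 2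
    -- the index is shifted, since `2 / 0 ^ b = 0`
    have h := eventually_le_klDiv (α := α) (C := C) (D := fun n => A (n + 1)) (H := H)
      (fun m n hmn => by
        refine enlargement_mono ?_
        gcongr)
      (fun n μ hμ ν hν m hm => midpoint_mem (hcomb (n + 1)) hμ hν hm)
      (fun β γ t hβ ht hts => mem_of_tendsto_enlargement hd hCclosed hne
        ((tendsto_add_atTop_iff_nat 1).2 hpow) hβ ht hts)
      (fun γ hγ hγfin => ENNReal.toReal_mono hγfin <| by
        rw [hαs.klDiv_eq]; exact iInf₂_le γ hγ) hη
    obtain ⟨N, hN⟩ := eventually_atTop.1 h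
    filter_upwards [eventually_ge_atTop (N + 1)] with n hn
    have := hN (n - 1) (by omega)
    rwa [Nat.sub_add_cancel (by omega)] at this
  refine ⟨?_, fun k => ?_⟩
  · filter_upwards [hlower 1 one_pos, eventually_ge_atTop 1] with n hn hn1
    have : NeZero n := ⟨by omega⟩
    rw [(conditionalLaw_eq hXmeas hXindep hXlaw le_rfl (hSm n)).1]
    exact (ENNReal.toReal_pos_iff.1 ((Real.exp_pos _).trans hn)).1
  -- convergence in total variation
  rw [ENNReal.tendsto_nhds_zero]
  intro ε hε
  obtain ⟨t, ht, htε⟩ : ∃ t : ℝ, 0 < t ∧ ENNReal.ofReal (3 * t) ≤ ε := by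
    obtain ⟨r, hr, hrε⟩ := ENNReal.lt_iff_exists_nnreal_btwn.1 hε
    have hr0 : (0 : ℝ) < r := by exact_mod_cast hr
    refine ⟨r / 3, by positivity, ?_⟩
    rw [mul_div_cancel₀ _ (three_ne_zero' ℝ), ENNReal.ofReal_coe_nnreal]
    exact hrε.le
  -- the gap in the parallelogram inequality will be `4 k η`
  set η : ℝ := t ^ 2 / (4 * (k + 1)) with hη
  have hηpos : 0 < η := by positivity
  -- the incomplete block at the end of the sample is negligible
  have hdiv : ∀ᶠ n : ℕ in atTop, (H + η) * k ≤ η * ((n : ℝ) - k) := by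
    have hlim : Tendsto (fun n : ℕ => η * ((n : ℝ) - k)) atTop atTop :=
      (tendsto_atTop_add_const_right _ (-(k : ℝ)) tendsto_natCast_atTop_atTop).const_mul_atTop hηpos
    exact hlim.eventually_ge_atTop _
  filter_upwards [hlower η hηpos, hinf η hηpos, hdiv, eventually_ge_atTop (k + 1)]
    with n hlow hinfn hdivn hnk
  have hn0 : NeZero n := ⟨by omega⟩
  have hkn : k ≤ n := by omega
  set S : Set (Fin n → EuclideanSpace ℝ (Fin q)) := {x | tupleEmpirical x ∈ A n} with hS
  set Pn := Measure.pi fun _ : Fin n => (α : Measure (EuclideanSpace ℝ (Fin q))) with hPn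
  have hpos : Pn S ≠ 0 := (ENNReal.toReal_pos_iff.1 ((Real.exp_pos _).trans hlow)).1.ne'
  have hprob : IsProbabilityMeasure (Pn[|S]) := cond_isProbabilityMeasure hpos
  have hsym : ∀ (σ : Equiv.Perm (Fin n)) x, x ∘ σ ∈ S ↔ x ∈ S := fun σ x => by
    simp only [hS, Set.mem_ofPred_eq, tupleEmpirical_comp_perm]
  have hm : ∀ {l : ℕ} (τ : Fin l ↪ Fin n),
      Measurable fun x : Fin n → EuclideanSpace ℝ (Fin q) => x ∘ τ :=
    fun τ => measurable_pi_iff.2 fun i => measurable_pi_apply (τ i)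
  set R := (Pn[|S]).map fun x => x ∘ Fin.castLEEmb hkn with hR
  have hRlaw : conditionalLaw P X n k (A n) = R :=
    (conditionalLaw_eq hXmeas hXindep hXlaw hkn (hSm n)).2
  have hRprob : IsProbabilityMeasure R := Measure.isProbabilityMeasure_map (hm _).aemeasurable
  obtain ⟨hRfin, hRle⟩ := klDiv_cond_pi_map_le (hSm n) hsym hpos (Fin.castLEEmb hkn)
  obtain ⟨hpfin, hpeq⟩ := klDiv_pi (ι := Fin k) hfin
  rw [Fintype.card_fin] at hpeq
  -- the one-dimensional marginal belongs to the enlargement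
  have hev : ∀ i : Fin n, Measurable fun x : Fin n → EuclideanSpace ℝ (Fin q) => x i :=
    fun i => measurable_pi_apply i
  let Q : ProbabilityMeasure (EuclideanSpace ℝ (Fin q)) :=
    ⟨(Pn[|S]).map fun x => x 0, Measure.isProbabilityMeasure_map (hev 0).aemeasurable⟩
  have hmarg : ∀ i : Fin n, (Pn[|S]).map (fun x => x i) =
      (Q : Measure (EuclideanSpace ℝ (Fin q))) := by
    intro i
    have hswap := cond_pi_map_comp_perm (ρ := (α : Measure (EuclideanSpace ℝ (Fin q)))) (hSm n)
      hsym (Equiv.swap i 0)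
    have hσ : Measurable fun x : Fin n → EuclideanSpace ℝ (Fin q) => x ∘ Equiv.swap i 0 :=
      measurable_pi_iff.2 fun l => measurable_pi_apply _
    conv_lhs => rw [← hswap, Measure.map_map (hev i) hσ]
    have : ((fun x : Fin n → EuclideanSpace ℝ (Fin q) => x i) ∘ fun x => x ∘ Equiv.swap i 0) =
        fun x => x 0 := by
      ext1 x; simp
    rw [this]; rfl
  have hQA : Q ∈ A n := by
    have hae : ∀ᵐ x ∂(Pn[|S]), tupleEmpirical x ∈ A n := ae_cond_mem (hSm n)
    refine marginal_mem_of_ae_tupleEmpirical_mem (κ := Fin q → ℤ) (R := Pn[|S]) (Q := Q)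
      (fun δ hδ => ⟨gridCell (δ / (√q + 1)), measurableSet_gridCell _,
        fun x y h => dist_le_of_gridCell_eq hδ h⟩)
      (hcomb n) (fun ν hν => mem_enlargement_of_forall_prohorovDist hd hne hν)
      hae hmarg
  -- lower bound for the entropy of the midpoint of the conditional law and of `αs^{⊗k}`: its
  -- marginals belong to `A n`
  have hmid : k * (H - η) ≤ (klDiv (midpointMeasure R (Measure.pi fun _ : Fin k =>
      (αs : Measure (EuclideanSpace ℝ (Fin q))))) (Measure.pi fun _ : Fin k =>
      (α : Measure (EuclideanSpace ℝ (Fin q))))).toReal := by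
    have hmfin := klDiv_midpointMeasure_ne_top hRfin hpfin
    have h1 := sum_klDiv_map_le (P := Measure.pi fun _ : Fin k =>
      (α : Measure (EuclideanSpace ℝ (Fin q)))) (Y := fun i x => x i)
      (fun i => measurable_pi_apply i)
      (iIndepFun_pi (X := fun _ y => y) fun _ => aemeasurable_id) hmfin
    refine le_trans ?_ h1
    have h2 : ∀ i : Fin k, H - η ≤ (klDiv ((midpointMeasure R (Measure.pi fun _ : Fin k =>
        (αs : Measure (EuclideanSpace ℝ (Fin q))))).map fun x => x i)
        ((Measure.pi fun _ : Fin k => (α : Measure (EuclideanSpace ℝ (Fin q)))).map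
          fun x => x i)).toReal := by
      intro i
      have e1 : (Measure.pi fun _ : Fin k => (α : Measure (EuclideanSpace ℝ (Fin q)))).map
          (fun x => x i) = α :=
        (measurePreserving_eval
          (fun _ : Fin k => (α : Measure (EuclideanSpace ℝ (Fin q)))) i).map_eq
      have e2 : (Measure.pi fun _ : Fin k => (αs : Measure (EuclideanSpace ℝ (Fin q)))).map
          (fun x => x i) = αs :=
        (measurePreserving_eval
          (fun _ : Fin k => (αs : Measure (EuclideanSpace ℝ (Fin q)))) i).map_eq
      have e3 : R.map (fun x => x i) = (Q : Measure (EuclideanSpace ℝ (Fin q))) := by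
        rw [hR, Measure.map_map (measurable_pi_apply i) (hm _)]
        exact hmarg (Fin.castLE hkn i)
      have e4 : klDiv ((midpointMeasure R (Measure.pi fun _ : Fin k =>
          (αs : Measure (EuclideanSpace ℝ (Fin q))))).map fun x => x i)
          ((Measure.pi fun _ : Fin k => (α : Measure (EuclideanSpace ℝ (Fin q)))).map
            fun x => x i) ≠ ∞ :=
        ne_top_of_le_ne_top hmfin (klDiv_map_le _ _ (measurable_pi_apply i))
      rw [midpointMeasure_map (measurable_pi_apply i), e1, e2, e3] at e4 ⊢
      exact hinfn ⟨midpointMeasure (Q : Measure (EuclideanSpace ℝ (Fin q))) αs, inferInstance⟩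
        (midpoint_mem (hcomb n) hQA (hαsA n) rfl) e4
    have h3 := Finset.sum_le_sum fun i (_ : i ∈ (Finset.univ : Finset (Fin k))) => h2 i
    rw [Finset.sum_const, Finset.card_univ, Fintype.card_fin, nsmul_eq_mul] at h3
    exact h3
  -- upper bound for the entropy of the conditional law
  have hupper : (klDiv R (Measure.pi fun _ : Fin k =>
      (α : Measure (EuclideanSpace ℝ (Fin q))))).toReal ≤ k * (H + 2 * η) := by
    rcases Nat.eq_zero_or_pos k with hk0 | hk0
    · have h1 : R = Measure.pi fun _ : Fin k => (α : Measure (EuclideanSpace ℝ (Fin q))) := by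
        subst hk0
        refine Measure.ext fun s hs => ?_
        rcases Set.eq_empty_or_nonempty s with rfl | hs'
        · simp
        · rw [Subsingleton.eq_univ_of_nonempty hs']; simp
      rw [h1, klDiv_self]
      simp [hk0]
    · have hk0' : (0 : ℝ) < k := by exact_mod_cast hk0
      have h1 : -Real.log (Pn.real S) ≤ n * (H + η) := by
        have := Real.log_le_log (Real.exp_pos _) hlow.le
        rw [Real.log_exp] at this
        linarith
      have hm1 : (0 : ℝ) < (n / k : ℕ) := by exact_mod_cast Nat.div_pos hkn hk0
      have h2 : (n : ℝ) < k * ((n / k : ℕ) + 1) := by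
        exact_mod_cast Nat.lt_mul_div_succ n hk0
      have h3 := hRle.trans h1
      set L := (klDiv R (Measure.pi fun _ : Fin k =>
        (α : Measure (EuclideanSpace ℝ (Fin q))))).toReal with hL
      set m : ℝ := ((n / k : ℕ) : ℝ) with hmdef
      have h4 : H + η ≤ η * m := by
        have h5 : (H + η) * k ≤ (η * m) * k := by nlinarith
        exact le_of_mul_le_mul_right h5 hk0'
      have h6 : m * L ≤ m * (k * (H + 2 * η)) := by
        calc m * L ≤ n * (H + η) := h3
          _ ≤ k * (m + 1) * (H + η) := by gcongr
          _ = m * (k * (H + η)) + k * (H + η) := by ring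
          _ ≤ m * (k * (H + η)) + k * (η * m) := by gcongr
          _ = m * (k * (H + 2 * η)) := by ring
      exact le_of_mul_le_mul_left h6 hm1
  -- the entropy is nearly affine between the conditional law and `αs^{⊗k}`, so that they are close
  have hgap : (klDiv R (Measure.pi fun _ : Fin k =>
      (α : Measure (EuclideanSpace ℝ (Fin q))))).toReal +
      (klDiv (Measure.pi fun _ : Fin k => (αs : Measure (EuclideanSpace ℝ (Fin q))))
        (Measure.pi fun _ : Fin k => (α : Measure (EuclideanSpace ℝ (Fin q))))).toReal -
      2 * (klDiv (midpointMeasure R (Measure.pi fun _ : Fin k =>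
      (αs : Measure (EuclideanSpace ℝ (Fin q))))) (Measure.pi fun _ : Fin k =>
      (α : Measure (EuclideanSpace ℝ (Fin q))))).toReal ≤ t ^ 2 := by
    rw [hpeq]
    have h1 : 4 * (k + 1) * η = t ^ 2 := by rw [hη]; field_simp
    have h2 : (0 : ℝ) ≤ k := Nat.cast_nonneg k
    nlinarith
  have hfinal := integral_abs_rnDeriv_sub_le hRfin hpfin ht hgap
  simp only [hRlaw]
  refine (tvDist_le_integral_abs (klDiv_ne_top_iff.1 hRfin).1 (klDiv_ne_top_iff.1 hpfin).1).trans ?_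
  exact (ENNReal.ofReal_le_ofReal hfinal).trans htε

/-- Exponential integrability under `α` transfers, by the entropy inequality, to a moment under any
measure of finite relative entropy. -/
lemma integrable_of_integrable_exp {F : Type*} [MeasurableSpace F] {μ ρ : Measure F}
    [IsProbabilityMeasure μ] [IsProbabilityMeasure ρ] (h : klDiv μ ρ ≠ ∞) {f : F → ℝ}
    (hf : Measurable f) (hf0 : ∀ x, 0 ≤ f x) {l : ℝ} (hl : 0 < l)
    (hexp : Integrable (fun x => Real.exp (l * f x)) ρ) : Integrable f μ := by
  have hac := (klDiv_ne_top_iff.1 h).1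
  have hlf : Integrable (fun x => l * f x) μ := by
    rw [← integrable_toReal_rnDeriv_mul_iff hac]
    refine ((integrable_klFun_of_klDiv_ne_top h).add hexp).mono'
      ((Measure.measurable_rnDeriv _ _).ennreal_toReal.mul
        (hf.const_mul l)).aestronglyMeasurable (ae_of_all _ fun x => ?_)
    have h1 := mul_log_le_klFun_add (f := (μ.rnDeriv ρ x).toReal) (g := Real.exp (l * f x))
      ENNReal.toReal_nonneg (Real.exp_pos _).le fun _ => Real.exp_pos _
    rw [Real.log_exp] at h1
    have h2 := hf0 x
    rw [Real.norm_of_nonneg (by positivity), Pi.add_apply]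
    linarith
  have := hlf.const_mul l⁻¹
  simpa [← mul_assoc, inv_mul_cancel₀ hl.ne'] using this

/-- Stretched exponential integrability implies the finiteness of all moments. -/
lemma integrable_norm_rpow_of_exp {F : Type*} [NormedAddCommGroup F] [MeasurableSpace F]
    [BorelSpace F] {μ : Measure F} [IsFiniteMeasure μ] {c l a : ℝ} (hc : 0 < c) (hl : 0 < l)
    (ha : 0 < a) (hexp : Integrable (fun x => Real.exp (l * ‖x‖ ^ c)) μ) :
    Integrable (fun x => ‖x‖ ^ a) μ := by
  have hlim := (tendsto_rpow_mul_exp_neg_mul_atTop_nhds_zero (a / c) l hl)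
  have hev := hlim.eventually_le_const one_pos
  obtain ⟨T, hT⟩ := eventually_atTop.1 hev
  set T' := max T 1
  refine ((integrable_const (T' ^ (a / c))).add hexp).mono'
    (Measurable.aestronglyMeasurable (by fun_prop)) (ae_of_all _ fun x => ?_)
  have hx := norm_nonneg x
  rw [Real.norm_of_nonneg (by positivity), Pi.add_apply]
  have h1 : ‖x‖ ^ a = (‖x‖ ^ c) ^ (a / c) := by
    rw [← Real.rpow_mul hx, mul_div_cancel₀ _ hc.ne']
  have hy : 0 ≤ ‖x‖ ^ c := by positivity
  have hT'0 : 0 ≤ T' := zero_le_one.trans (le_max_right _ _)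
  rw [h1]
  rcases le_total (‖x‖ ^ c) T' with h2 | h2
  · have := Real.rpow_le_rpow hy h2 (by positivity : 0 ≤ a / c)
    have := Real.exp_pos (l * ‖x‖ ^ c)
    linarith
  · have h3 := hT _ ((le_max_left _ _).trans h2)
    rw [neg_mul, Real.exp_neg, ← div_eq_mul_inv, div_le_one (Real.exp_pos _)] at h3
    have : 0 ≤ T' ^ (a / c) := by positivity
    linarith

end Main

end GibbsConditioning

theorem proposition5p1 (q : ℕ)
    (α αs : ProbabilityMeasure (EuclideanSpace ℝ (Fin q)))
    (C : Set (ProbabilityMeasure (EuclideanSpace ℝ (Fin q))))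
    (hCclosed : IsClosed C) (hCconvex : GibbsConditioning.IsConvexSet C)
    (hCfinite : GibbsConditioning.entropyInf C α < ∞)
    (hαs : GibbsConditioning.IsIProjection C α αs)
    (dbar : ProbabilityMeasure (EuclideanSpace ℝ (Fin q)) →
      ProbabilityMeasure (EuclideanSpace ℝ (Fin q)) → ℝ)
    (hdbar : dbar = GibbsConditioning.prohorovDist ∨ dbar = GibbsConditioning.fortetMourierDist)
    {Ω : Type*} [MeasurableSpace Ω] (P : Measure Ω) [IsProbabilityMeasure P]
    (X : ℕ → Ω → EuclideanSpace ℝ (Fin q)) (hXmeas : ∀ i, Measurable (X i))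
    (hXindep : iIndepFun X P)
    (hXlaw : ∀ i, P.map (X i) = (α : Measure (EuclideanSpace ℝ (Fin q)))) :
    -- a moment of order `a > q`
    (∀ a : ℝ, q < a → Integrable (fun x => ‖x‖ ^ a) (αs : Measure (EuclideanSpace ℝ (Fin q))) →
      ∀ b : ℝ, 0 < b → b < (1 - q / a) / (2 + q) →
        GibbsConditioning.GibbsConvergence P X
          (fun n => GibbsConditioning.enlargement dbar C (2 / (n : ℝ) ^ b)) αs) ∧
    -- exponential integrability of `α` is sufficient for this moment condition
    (∀ a : ℝ, q < a → ∀ l : ℝ, 0 < l →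
      Integrable (fun x => Real.exp (l * ‖x‖ ^ a)) (α : Measure (EuclideanSpace ℝ (Fin q))) →
        Integrable (fun x => ‖x‖ ^ a) (αs : Measure (EuclideanSpace ℝ (Fin q)))) ∧
    -- exponential integrability of `αs`, of any positive order `c`
    (∀ c : ℝ, 0 < c → ∀ l : ℝ, 0 < l →
      Integrable (fun x => Real.exp (l * ‖x‖ ^ c)) (αs : Measure (EuclideanSpace ℝ (Fin q))) →
      ∀ b : ℝ, 0 < b → b < 1 / (2 + q) →
        GibbsConditioning.GibbsConvergence P X
          (fun n => GibbsConditioning.enlargement dbar C (2 / (n : ℝ) ^ b)) αs) ∧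
    -- a moment of order `a > q`, and `log (dαs/dα)` bounded and continuous
    (∀ a : ℝ, q < a → Integrable (fun x => ‖x‖ ^ a) (αs : Measure (EuclideanSpace ℝ (Fin q))) →
      (∃ h : BoundedContinuousFunction (EuclideanSpace ℝ (Fin q)) ℝ,
        (αs : Measure (EuclideanSpace ℝ (Fin q))).rnDeriv α
          =ᵐ[(α : Measure (EuclideanSpace ℝ (Fin q)))] fun x => ENNReal.ofReal (Real.exp (h x))) →
      ∀ b : ℝ, 0 < b → b < 1 / (2 + q) →
        GibbsConditioning.GibbsConvergence P X
          (fun n => GibbsConditioning.enlargement dbar C (2 / (n : ℝ) ^ b)) αs) := by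
  have hd : GibbsConditioning.AdmissibleDist dbar := by
    rcases hdbar with rfl | rfl
    · exact GibbsConditioning.admissibleDist_prohorovDist
    · exact GibbsConditioning.admissibleDist_fortetMourierDist
  have hmain : ∀ a : ℝ, q < a →
      Integrable (fun x => ‖x‖ ^ a) (αs : Measure (EuclideanSpace ℝ (Fin q))) →
      ∀ b : ℝ, 0 < b → b < 1 / (2 + q) →
        GibbsConditioning.GibbsConvergence P X
          (fun n => GibbsConditioning.enlargement dbar C (2 / (n : ℝ) ^ b)) αs :=
    fun a ha hmom b hb hbq => GibbsConditioning.gibbsConvergence_of_moment hCclosed hCconvex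
      hCfinite hαs hd hXmeas hXindep hXlaw ha hmom hb hbq
  have hfin : InformationTheory.klDiv (αs : Measure (EuclideanSpace ℝ (Fin q))) α ≠ ∞ := by
    rw [hαs.klDiv_eq]; exact hCfinite.ne
  refine ⟨fun a ha hmom b hb hbq => hmain a ha hmom b hb (hbq.trans_le ?_),
    fun a ha l hl hexp => ?_, fun c hc l hl hexp b hb hbq => ?_,
    fun a ha hmom _ b hb hbq => hmain a ha hmom b hb hbq⟩
  · have ha0 : 0 ≤ a := (Nat.cast_nonneg q).trans ha.le
    have : 0 ≤ (q : ℝ) / a := by positivity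
    gcongr
    linarith
  · exact GibbsConditioning.integrable_of_integrable_exp hfin (by fun_prop)
      (fun x => by positivity) hl hexp
  -- all moments are finite, in particular the moment of order `q + 1`
  · exact hmain (q + 1) (by linarith) (GibbsConditioning.integrable_norm_rpow_of_exp hc hl
      (by positivity) hexp) b hb hbq
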